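/- **Corollary (convergence rate of LightSAM-I).** Let $f(x)=\frac1n\sum_{i=1}^n \ell_i(x)$ on $\mathbb R^d$ ($n\ge 1$), and for a minibatch $B=(B_1,\dots,B_b)\in\{1,\dots,n\}^b$ ($b\ge1$) put $f(x,B)=\frac1b\sum_{j=1}^b \ell_{B_j}(x)$. LightSAM-I with perturbation radius $\rho\ge 0$, learning rate $\eta>0$ and $\epsilon>0$ starts from a deterministic point $x_1$ with $u_0=v_0=\epsilon^2$ and, for $t=1,2,\dots$, samples a random minibatch $\xi_t$ and sets $$s_t=\nabla f(x_t,\xi_t),\quad u_t=u_{t-1}+\|s_t\|^2,\quad w_t=x_t+\rho\frac{s_t}{\sqrt{u_t}},\quad g_t=\nabla f(w_t,\xi_t),\quad v_t=v_{t-1}+\|g_t\|^2,\quad x_{t+1}=x_t-\eta\frac{g_t}{\sqrt{v_t}} .$$ Let $\mathcal F_t=\sigma\{s_1,g_1,\dots,s_t,g_t\}$. Assume: * ($L$-smoothness) every $\ell_i$ is differentiable and $\|\nabla \ell_i(x)-\nabla \ell_i(y)\|\le L\|x-y\|$ for all $x,y$, where $L\ge0$; * (sampling) for every $t\ge0$,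 conditionally on $\mathcal F_t$, each single index of $\xi_{t+1}$ is uniformly distributed on $\{1,\dots,n\}$ (for instance, minibatches drawn independently over $t$ and uniformly, with or without replacement inside a minibatch); * (affine noise variance) with constants $D_0,D_1>0$, for every $t\ge0$ and every $x\in\mathbb R^d$, $\mathbb E\big[\|\nabla f(x,\xi_{t+1})\|^2\,\big|\,\mathcal F_t\big]\le D_0+D_1\|\nabla f(x)\|^2$ almost surely; * $f$ is bounded below. Define $\hat w_1=x_1+\rho\,\nabla f(x_1)/\sqrt{\epsilon^2+\|\nabla f(x_1)\|^2}$ and $$D_2=\max\Big\{1,\,4D_1,\,\frac{32(1+\sqrt{D_1})D_1\rho\sqrt{\rho L+\epsilon}}{\eta\sqrt\epsilon}\Big\},\qquad A_1=\frac{\|\nabla f(\hat w_1)\|^2}{\epsilon}+\frac{4(1+2D_2)L^2}{\epsilon}\big(\eta^2-4\rho^2\ln\epsilon\big),$$ $$A_2=2\rho^2L+\frac{\rho D_0}{2\epsilon\sqrt{D_1}}+\rho\|\nabla f(x_1)\|+\frac{(D_0+4\rho^2L^2)\eta}{\epsilon}+\mathbb E f(w_1)-\Big(\frac{12\rho^2\eta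 L^2}{\epsilon}+\eta+\rho+(1+\rho L)(2\eta^2L+8\rho^2L)\Big)\ln\epsilon,$$ $$A_3=\sqrt{\tfrac{\rho L}{\epsilon}+1}\,\Big[\frac{4f(x_1)}{\eta}+\frac{8(D_0+4\rho^2L^2)}{\epsilon}+16D_1A_1+\frac{8A_2}{\eta}-\Big(\frac{80\rho^2L^2}{\epsilon}+4\eta L\Big)\ln\epsilon+\big(4\eta L(3+\rho L)+8\big)\ln\Big(1+\frac{\rho L}{\epsilon}\Big)\Big],$$ $$A_4=\sqrt{\tfrac{\rho L}{\epsilon}+1}\;\frac{16\big(8(1+2D_2)D_1+3\big)\rho^2L^2}{\epsilon},\qquad A_5=\sqrt{\tfrac{\rho L}{\epsilon}+1}\,\Big[\frac{40\rho^2L^2}{\epsilon}+\frac{4\rho}{\eta}\big(1+8\rho L(1+\rho L)\big)+4\eta L(3+2\rho L)+8\Big],$$ $$A_6=2\sqrt{2D_0T+\epsilon^2}+4D_1A_3+8D_1A_5\ln(4D_1A_5+e),\qquad A_7=2A_4A_6+16D_1A_4A_5+8D_1A_4\big(A_3+2A_5\ln A_6\big).$$ Then, as $T\to\infty$, $A_6=O(\sqrt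 T)$ and $A_7=O(\sqrt T+\ln T)$, and the expectations $\mathbb E\|\nabla f(x_t)\|$ are finite and satisfy $$\frac1T\sum_{t=1}^T\mathbb E\|\nabla f(x_t)\|\;\le\; C\,\frac{\ln T}{T^{1/4}}\qquad\text{for all } T\ge 2,$$ where for each $\Delta\in\mathbb R$ one constant $C$, depending only on $L,D_0,D_1,\epsilon,\rho,\eta,\Delta$, serves all such problems and runs with $f(x_1)-\inf f\le\Delta$ (in particular $C$ does not depend on $T,d,n,b$). No relation between $\rho,\eta$ and the constants $L,D_0,D_1$ of the problem is required (the parameter-agnostic property). -/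

import Mathlib

open MeasureTheory

noncomputable section

namespace LightSAM

/-- The objective `f(x) = (1/n) ∑ᵢ ℓᵢ(x)`, the average loss over a dataset of `n` points. -/
def risk {d n : ℕ} (ℓ : Fin n → EuclideanSpace ℝ (Fin d) → ℝ)
    (x : EuclideanSpace ℝ (Fin d)) : ℝ :=
  (1 / (n : ℝ)) * ∑ i, ℓ i x

/-- The loss `f(x, B)` on a minibatch `B`, a list of `b` indices into the dataset. -/
def batchLoss {d n b : ℕ} (ℓ : Fin n → EuclideanSpace ℝ (Fin d) → ℝ) (B : Fin b → Fin n)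
    (x : EuclideanSpace ℝ (Fin d)) : ℝ :=
  (1 / (b : ℝ)) * ∑ j, ℓ (B j) x

/-- What the algorithm carries from one iteration to the next: after iteration `t` these are
`x_{t+1}`, `u_t` and `v_t`. -/
structure State (d : ℕ) where
  x : EuclideanSpace ℝ (Fin d)
  u : ℝ
  v : ℝ

/-- One iteration of LightSAM-I with minibatch `B`. -/
def step {d n b : ℕ} (ℓ : Fin n → EuclideanSpace ℝ (Fin d) → ℝ) (ρ η : ℝ) (B : Fin b → Fin n)
    (S : State d) : State d :=
  let s := gradient (batchLoss ℓ B) S.x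
  let u := S.u + ‖s‖ ^ 2
  let w := S.x + (ρ / √u) • s
  let g := gradient (batchLoss ℓ B) w
  let v := S.v + ‖g‖ ^ 2
  { x := S.x - (η / √v) • g, u := u, v := v }

/-- The state after `t` iterations, started at `x₁` with `u₀ = v₀ = ε²`; iteration `t ≥ 1` uses
the minibatch `B t`. -/
def state {d n b : ℕ} (ℓ : Fin n → EuclideanSpace ℝ (Fin d) → ℝ)
    (x₁ : EuclideanSpace ℝ (Fin d)) (ε ρ η : ℝ) (B : ℕ → Fin b → Fin n) : ℕ → State d
  | 0 => { x := x₁, u := ε ^ 2, v := ε ^ 2 }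
  | t + 1 => step ℓ ρ η (B (t + 1)) (state ℓ x₁ ε ρ η B t)

/-- The iterate `x_t`, for `t ≥ 1`. -/
def iterate {d n b : ℕ} (ℓ : Fin n → EuclideanSpace ℝ (Fin d) → ℝ)
    (x₁ : EuclideanSpace ℝ (Fin d)) (ε ρ η : ℝ) (B : ℕ → Fin b → Fin n) (t : ℕ) :
    EuclideanSpace ℝ (Fin d) :=
  (state ℓ x₁ ε ρ η B (t - 1)).x

/-- The first stochastic gradient `s_t = ∇f(x_t, ξ_t)`, for `t ≥ 1`. -/
def gradS {d n b : ℕ} (ℓ : Fin n → EuclideanSpace ℝ (Fin d) → ℝ)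
    (x₁ : EuclideanSpace ℝ (Fin d)) (ε ρ η : ℝ) (B : ℕ → Fin b → Fin n) (t : ℕ) :
    EuclideanSpace ℝ (Fin d) :=
  gradient (batchLoss ℓ (B t)) (iterate ℓ x₁ ε ρ η B t)

/-- The perturbed weights `w_t = x_t + ρ s_t / √u_t`, for `t ≥ 1`. -/
def perturbed {d n b : ℕ} (ℓ : Fin n → EuclideanSpace ℝ (Fin d) → ℝ)
    (x₁ : EuclideanSpace ℝ (Fin d)) (ε ρ η : ℝ) (B : ℕ → Fin b → Fin n) (t : ℕ) :
    EuclideanSpace ℝ (Fin d) :=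
  iterate ℓ x₁ ε ρ η B t
    + (ρ / √(state ℓ x₁ ε ρ η B t).u) • gradS ℓ x₁ ε ρ η B t

/-- The second stochastic gradient `g_t = ∇f(w_t, ξ_t)`, for `t ≥ 1`. -/
def gradG {d n b : ℕ} (ℓ : Fin n → EuclideanSpace ℝ (Fin d) → ℝ)
    (x₁ : EuclideanSpace ℝ (Fin d)) (ε ρ η : ℝ) (B : ℕ → Fin b → Fin n) (t : ℕ) :
    EuclideanSpace ℝ (Fin d) :=
  gradient (batchLoss ℓ (B t)) (perturbed ℓ x₁ ε ρ η B t)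

/-- The σ-algebra `ℱ_t = σ{s₁, g₁, …, s_t, g_t}` of the first `t` iterations, when the minibatches
are the random `ξ 1, ξ 2, …`. -/
abbrev history {Ω : Type*} {d n b : ℕ} (ℓ : Fin n → EuclideanSpace ℝ (Fin d) → ℝ)
    (x₁ : EuclideanSpace ℝ (Fin d)) (ε ρ η : ℝ) (ξ : ℕ → Ω → Fin b → Fin n) (t : ℕ) :
    MeasurableSpace Ω :=
  ⨆ k ∈ Finset.Icc 1 t,
    MeasurableSpace.comap (fun ω => gradS ℓ x₁ ε ρ η (fun r => ξ r ω) k) inferInstance ⊔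
    MeasurableSpace.comap (fun ω => gradG ℓ x₁ ε ρ η (fun r => ξ r ω) k) inferInstance

/-- `L`-smoothness of every loss. -/
def LSmooth {d n : ℕ} (ℓ : Fin n → EuclideanSpace ℝ (Fin d) → ℝ) (L : ℝ) : Prop :=
  ∀ i, Differentiable ℝ (ℓ i) ∧
    ∀ x y, ‖gradient (ℓ i) x - gradient (ℓ i) y‖ ≤ L * ‖x - y‖

/-- The minibatches are sampled from the dataset: given the past `ℱ_t`, each of the `b` indices of
`ξ_{t+1}` is uniformly distributed on the `n` data points. The indices inside one minibatch may
depend on each other, so sampling with and without replacement are both covered. -/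
def UniformSampling {Ω : Type*} [MeasurableSpace Ω] (μ : Measure Ω) {d n b : ℕ}
    (ℓ : Fin n → EuclideanSpace ℝ (Fin d) → ℝ)
    (x₁ : EuclideanSpace ℝ (Fin d)) (ε ρ η : ℝ) (ξ : ℕ → Ω → Fin b → Fin n) : Prop :=
  (∀ t, Measurable (ξ t)) ∧
    ∀ (t : ℕ) (j : Fin b) (i : Fin n),
      μ[fun ω => if ξ (t + 1) ω j = i then (1 : ℝ) else 0 | history ℓ x₁ ε ρ η ξ t]
        =ᵐ[μ] fun _ => 1 / (n : ℝ)

/-- Affine noise variance: `𝔼[‖∇f(x, ξ_{t+1})‖² | ℱ_t] ≤ D₀ + D₁ ‖∇f(x)‖²` for every `x`. -/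
def AffineVariance {Ω : Type*} [MeasurableSpace Ω] (μ : Measure Ω) {d n b : ℕ}
    (ℓ : Fin n → EuclideanSpace ℝ (Fin d) → ℝ)
    (x₁ : EuclideanSpace ℝ (Fin d)) (ε ρ η : ℝ) (ξ : ℕ → Ω → Fin b → Fin n)
    (D₀ D₁ : ℝ) : Prop :=
  ∀ (t : ℕ) (x : EuclideanSpace ℝ (Fin d)),
    μ[fun ω => ‖gradient (batchLoss ℓ (ξ (t + 1) ω)) x‖ ^ 2 | history ℓ x₁ ε ρ η ξ t]
      ≤ᵐ[μ] fun _ => D₀ + D₁ * ‖gradient (risk ℓ) x‖ ^ 2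

/-- `ŵ₁ = x₁ + ρ ∇f(x₁) / √(ε² + ‖∇f(x₁)‖²)`. -/
def wHat₁ {d n : ℕ} (ℓ : Fin n → EuclideanSpace ℝ (Fin d) → ℝ)
    (x₁ : EuclideanSpace ℝ (Fin d)) (ε ρ : ℝ) : EuclideanSpace ℝ (Fin d) :=
  x₁ + (ρ / √(ε ^ 2 + ‖gradient (risk ℓ) x₁‖ ^ 2)) • gradient (risk ℓ) x₁

/-! The constants. `G` stands for `‖∇f(ŵ₁)‖`, `N` for `‖∇f(x₁)‖`, `F` for `f(x₁)` and `W` for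
`𝔼 f(w₁)`. -/

def D2 (L D₁ ε ρ η : ℝ) : ℝ :=
  max 1 (max (4 * D₁) (32 * (1 + √D₁) * D₁ * ρ * √(ρ * L + ε) / (η * √ε)))

def A1 (L D₁ ε ρ η G : ℝ) : ℝ :=
  G ^ 2 / ε + 4 * (1 + 2 * D2 L D₁ ε ρ η) * L ^ 2 / ε * (η ^ 2 - 4 * ρ ^ 2 * Real.log ε)

def A2 (L D₀ D₁ ε ρ η N W : ℝ) : ℝ :=
  2 * ρ ^ 2 * L + ρ * D₀ / (2 * ε * √D₁) + ρ * N + (D₀ + 4 * ρ ^ 2 * L ^ 2) * η / ε + W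
    - (12 * ρ ^ 2 * η * L ^ 2 / ε + η + ρ + (1 + ρ * L) * (2 * η ^ 2 * L + 8 * ρ ^ 2 * L))
      * Real.log ε

def A3 (L D₀ D₁ ε ρ η G N F W : ℝ) : ℝ :=
  √(ρ * L / ε + 1) *
    (4 * F / η + 8 * (D₀ + 4 * ρ ^ 2 * L ^ 2) / ε + 16 * D₁ * A1 L D₁ ε ρ η G
      + 8 * A2 L D₀ D₁ ε ρ η N W / η
      - (80 * ρ ^ 2 * L ^ 2 / ε + 4 * η * L) * Real.log ε
      + (4 * η * L * (3 + ρ * L) + 8) * Real.log (1 + ρ * L / ε))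

def A4 (L D₁ ε ρ η : ℝ) : ℝ :=
  √(ρ * L / ε + 1) * (16 * (8 * (1 + 2 * D2 L D₁ ε ρ η) * D₁ + 3) * ρ ^ 2 * L ^ 2 / ε)

def A5 (L ε ρ η : ℝ) : ℝ :=
  √(ρ * L / ε + 1) *
    (40 * ρ ^ 2 * L ^ 2 / ε + 4 * ρ / η * (1 + 8 * ρ * L * (1 + ρ * L))
      + 4 * η * L * (3 + 2 * ρ * L) + 8)

def A6 (L D₀ D₁ ε ρ η G N F W : ℝ) (T : ℕ) : ℝ :=
  2 * √(2 * D₀ * T + ε ^ 2) + 4 * D₁ * A3 L D₀ D₁ ε ρ η G N F W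
    + 8 * D₁ * A5 L ε ρ η * Real.log (4 * D₁ * A5 L ε ρ η + Real.exp 1)

def A7 (L D₀ D₁ ε ρ η G N F W : ℝ) (T : ℕ) : ℝ :=
  2 * A4 L D₁ ε ρ η * A6 L D₀ D₁ ε ρ η G N F W T
    + 16 * D₁ * A4 L D₁ ε ρ η * A5 L ε ρ η
    + 8 * D₁ * A4 L D₁ ε ρ η *
      (A3 L D₀ D₁ ε ρ η G N F W
        + 2 * A5 L ε ρ η * Real.log (A6 L D₀ D₁ ε ρ η G N F W T))

/-- `A₆` for a given run of the algorithm, as a function of `T`. -/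
def runA6 {Ω : Type*} [MeasurableSpace Ω] (μ : Measure Ω) {d n b : ℕ}
    (ℓ : Fin n → EuclideanSpace ℝ (Fin d) → ℝ)
    (x₁ : EuclideanSpace ℝ (Fin d)) (ε ρ η : ℝ) (ξ : ℕ → Ω → Fin b → Fin n)
    (L D₀ D₁ : ℝ) (T : ℕ) : ℝ :=
  A6 L D₀ D₁ ε ρ η ‖gradient (risk ℓ) (wHat₁ ℓ x₁ ε ρ)‖ ‖gradient (risk ℓ) x₁‖ (risk ℓ x₁)
    (∫ ω, risk ℓ (perturbed ℓ x₁ ε ρ η (fun r => ξ r ω) 1) ∂μ) T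

/-- `A₇` for a given run of the algorithm, as a function of `T`. -/
def runA7 {Ω : Type*} [MeasurableSpace Ω] (μ : Measure Ω) {d n b : ℕ}
    (ℓ : Fin n → EuclideanSpace ℝ (Fin d) → ℝ)
    (x₁ : EuclideanSpace ℝ (Fin d)) (ε ρ η : ℝ) (ξ : ℕ → Ω → Fin b → Fin n)
    (L D₀ D₁ : ℝ) (T : ℕ) : ℝ :=
  A7 L D₀ D₁ ε ρ η ‖gradient (risk ℓ) (wHat₁ ℓ x₁ ε ρ)‖ ‖gradient (risk ℓ) x₁‖ (risk ℓ x₁)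
    (∫ ω, risk ℓ (perturbed ℓ x₁ ε ρ η (fun r => ξ r ω) 1) ∂μ) T

end LightSAM

end

/-! The proof is an AdaGrad-norm argument applied to `v`, with the perturbation treated as a
controlled error. Write `G = ∇f(x)`, and let `a` and `b` be the square roots of the accumulator `v`
before and after an iteration. In the descent inequality the step size `1 / b` is correlated with
the gradient `g`. It is therefore replaced by the predictable `1 / a`, and `g` by the unbiased `s`,
which produces the decrease `‖G‖² / a` in expectation.

Three errors arise. The difference `g - s` is at most `Lρ ‖s‖ / √u`, so its square telescopes into
`log u`. The step size error is split by Young's inequality with weight `P + Q ‖G‖²`, which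
dominates the conditional mean of `‖g‖²`. One piece is absorbed by the decrease, one telescopes into
`log v`, and the last, `2 Q ‖G‖² (1 / a - 1 / b)`, telescopes once `2 Q ‖G‖² / √v` is added to the
Lyapunov function (`potential_step_le`). Hence the sum `S` of the expectations of `‖G‖² / √v` is at
most a constant plus a multiple of the expected logarithms of the accumulators
(`sum_integral_gradTerm_le`).

Conversely, the expectation `W` of `√(v + P (k + 1))` is `O(√T) + Q S` (`integral_sqrt_le`), and
both logarithms are controlled by `W`. This loop closes with `W = O(√T)` and `S = O(log T)`
(`exists_le_mul_sqrt`, `le_mul_log`) without any condition on `ρ` or `η`. Finally `‖G‖ ≤ θ ‖G‖² / √v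
+ θ⁻¹ √v` with `θ = T^(3/4)` gives the rate.

The constants `A₁, …, A₇` play no role in the rate; the growth of `A₆` and `A₇` is read off from
their formulas. -/

open MeasureTheory
open scoped InnerProductSpace

noncomputable section

namespace LightSAM

/-! ### Smoothness of the minibatch losses and of the objective -/

section Smoothness

variable {d n b : ℕ} {ℓ : Fin n → EuclideanSpace ℝ (Fin d) → ℝ} {L : ℝ}

lemma LSmooth.mono {L' : ℝ} (h : LSmooth ℓ L) (hL : L ≤ L') : LSmooth ℓ L' := fun i =>
  ⟨(h i).1, fun x y => ((h i).2 x y).trans (by gcongr)⟩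

lemma LSmooth.hasGradientAt_batchLoss (h : LSmooth ℓ L) (B : Fin b → Fin n)
    (x : EuclideanSpace ℝ (Fin d)) :
    HasGradientAt (batchLoss ℓ B) ((1 / (b : ℝ)) • ∑ j, gradient (ℓ (B j)) x) x := by
  rw [hasGradientAt_iff_hasFDerivAt, map_smul, map_sum]
  exact (HasFDerivAt.fun_sum fun j _ => ((h (B j)).1 x).hasGradientAt.hasFDerivAt).const_mul _

lemma LSmooth.gradient_batchLoss (h : LSmooth ℓ L) (B : Fin b → Fin n)
    (x : EuclideanSpace ℝ (Fin d)) :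
    gradient (batchLoss ℓ B) x = (1 / (b : ℝ)) • ∑ j, gradient (ℓ (B j)) x :=
  (h.hasGradientAt_batchLoss B x).gradient

lemma LSmooth.norm_gradient_batchLoss_sub_le (h : LSmooth ℓ L) (hb : 0 < b) (B : Fin b → Fin n)
    (x y : EuclideanSpace ℝ (Fin d)) :
    ‖gradient (batchLoss ℓ B) x - gradient (batchLoss ℓ B) y‖ ≤ L * ‖x - y‖ := by
  have hb' : (0 : ℝ) < b := by exact_mod_cast hb
  rw [h.gradient_batchLoss, h.gradient_batchLoss, ← smul_sub, ← Finset.sum_sub_distrib, norm_smul,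
    Real.norm_of_nonneg (by positivity)]
  have : ‖∑ j, (gradient (ℓ (B j)) x - gradient (ℓ (B j)) y)‖ ≤ ∑ _j : Fin b, L * ‖x - y‖ :=
    norm_sum_le_of_le _ fun j _ => (h (B j)).2 x y
  calc _ ≤ 1 / (b : ℝ) * ∑ _j : Fin b, L * ‖x - y‖ := by gcongr
    _ = L * ‖x - y‖ := by
      simp only [Finset.sum_const, Finset.card_univ, Fintype.card_fin, nsmul_eq_mul]
      field_simp

lemma LSmooth.gradient_risk (h : LSmooth ℓ L) (x : EuclideanSpace ℝ (Fin d)) :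
    gradient (risk ℓ) x = (1 / (n : ℝ)) • ∑ i, gradient (ℓ i) x :=
  h.gradient_batchLoss id x

lemma LSmooth.norm_gradient_risk_sub_le (h : LSmooth ℓ L) (hn : 0 < n)
    (x y : EuclideanSpace ℝ (Fin d)) :
    ‖gradient (risk ℓ) x - gradient (risk ℓ) y‖ ≤ L * ‖x - y‖ :=
  h.norm_gradient_batchLoss_sub_le hn id x y

/-- The descent inequality, with constant `L` instead of the sharp `L / 2`. -/
lemma LSmooth.risk_le (h : LSmooth ℓ L) (hL : 0 ≤ L) (hn : 0 < n)
    (x y : EuclideanSpace ℝ (Fin d)) :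
    risk ℓ y ≤ risk ℓ x + ⟪gradient (risk ℓ) x, y - x⟫_ℝ + L * ‖y - x‖ ^ 2 := by
  have hd : ∀ z, HasFDerivAt (risk ℓ)
      (InnerProductSpace.toDual ℝ _ (gradient (risk ℓ) z)) z := fun z => by
    have := (h.hasGradientAt_batchLoss id z)
    rw [← h.gradient_batchLoss id z] at this
    exact this.hasFDerivAt
  -- Mean value inequality for `f` minus its linearization at `x`, whose derivative on the segment
  -- is at most `L * ‖y - x‖`.
  have key := (convex_segment (𝕜 := ℝ) x y).norm_image_sub_le_of_norm_hasFDerivWithin_le'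
    (C := L * ‖y - x‖) (φ := InnerProductSpace.toDual ℝ _ (gradient (risk ℓ) x))
    (fun z _ => (hd z).hasFDerivWithinAt) (fun z hz => by
      rw [← map_sub, LinearIsometryEquiv.norm_map]
      refine (h.norm_gradient_risk_sub_le hn z x).trans ?_
      have := norm_sub_le_of_mem_segment hz
      gcongr) (left_mem_segment ℝ x y) (right_mem_segment ℝ x y)
  have := (Real.le_norm_self _).trans key
  rw [InnerProductSpace.toDual_apply_apply] at this
  nlinarith

/-- A gradient step of size `1 / (2 * L)` cannot bring `f` below its infimum. This is what makes the
initial value of the Lyapunov function depend on the problem only through `Δ`. -/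
lemma LSmooth.norm_gradient_risk_sq_le (h : LSmooth ℓ L) (hL : 0 < L) (hn : 0 < n)
    (hbdd : BddBelow (Set.range (risk ℓ))) (x : EuclideanSpace ℝ (Fin d)) :
    ‖gradient (risk ℓ) x‖ ^ 2 ≤ 4 * L * (risk ℓ x - ⨅ y, risk ℓ y) := by
  have h1 := h.risk_le hL.le hn x (x - (1 / (2 * L)) • gradient (risk ℓ) x)
  have h2 := ciInf_le hbdd (x - (1 / (2 * L)) • gradient (risk ℓ) x)
  rw [sub_sub_cancel_left, inner_neg_right, real_inner_smul_right, real_inner_self_eq_norm_sq,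
    norm_neg, norm_smul, Real.norm_of_nonneg (by positivity)] at h1
  have e : risk ℓ x + -(1 / (2 * L) * ‖gradient (risk ℓ) x‖ ^ 2)
      + L * (1 / (2 * L) * ‖gradient (risk ℓ) x‖) ^ 2
      = risk ℓ x - ‖gradient (risk ℓ) x‖ ^ 2 / (4 * L) := by
    field_simp; ring
  rw [e] at h1
  have h3 : ‖gradient (risk ℓ) x‖ ^ 2 / (4 * L) ≤ risk ℓ x - ⨅ y, risk ℓ y := by linarith
  rw [div_le_iff₀ (by positivity)] at h3
  linarith

end Smoothness

/-! ### Pathwise bounds along a run -/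

section Run

variable {d n b : ℕ} {ℓ : Fin n → EuclideanSpace ℝ (Fin d) → ℝ} {L : ℝ}
  {x₁ : EuclideanSpace ℝ (Fin d)} {ε ρ η : ℝ} (B : ℕ → Fin b → Fin n)

lemma state_u_succ (k : ℕ) : (state ℓ x₁ ε ρ η B (k + 1)).u
    = (state ℓ x₁ ε ρ η B k).u + ‖gradS ℓ x₁ ε ρ η B (k + 1)‖ ^ 2 := rfl

lemma state_v_succ (k : ℕ) : (state ℓ x₁ ε ρ η B (k + 1)).v
    = (state ℓ x₁ ε ρ η B k).v + ‖gradG ℓ x₁ ε ρ η B (k + 1)‖ ^ 2 := rfl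

lemma state_x_succ (k : ℕ) : (state ℓ x₁ ε ρ η B (k + 1)).x
    = (state ℓ x₁ ε ρ η B k).x
      - (η / √(state ℓ x₁ ε ρ η B (k + 1)).v) • gradG ℓ x₁ ε ρ η B (k + 1) := rfl

lemma le_state_u (k : ℕ) : ε ^ 2 ≤ (state ℓ x₁ ε ρ η B k).u := by
  induction k with
  | zero => exact le_rfl
  | succ k ih => rw [state_u_succ]; nlinarith [sq_nonneg ‖gradS ℓ x₁ ε ρ η B (k + 1)‖]

lemma le_state_v (k : ℕ) : ε ^ 2 ≤ (state ℓ x₁ ε ρ η B k).v := by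
  induction k with
  | zero => exact le_rfl
  | succ k ih => rw [state_v_succ]; nlinarith [sq_nonneg ‖gradG ℓ x₁ ε ρ η B (k + 1)‖]

/-- The two stochastic gradients of one iteration differ by at most the normalized perturbation. -/
lemma norm_gradG_sub_gradS_sq_le (h : LSmooth ℓ L) (hb : 0 < b) (hε : 0 < ε)
    (hρ : 0 ≤ ρ) (k : ℕ) :
    ‖gradG ℓ x₁ ε ρ η B (k + 1) - gradS ℓ x₁ ε ρ η B (k + 1)‖ ^ 2
      ≤ L ^ 2 * ρ ^ 2 * (‖gradS ℓ x₁ ε ρ η B (k + 1)‖ ^ 2 / (state ℓ x₁ ε ρ η B (k + 1)).u) := by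
  have hu : 0 < (state ℓ x₁ ε ρ η B (k + 1)).u := lt_of_lt_of_le (by positivity) (le_state_u B _)
  have := h.norm_gradient_batchLoss_sub_le hb (B (k + 1)) (perturbed ℓ x₁ ε ρ η B (k + 1))
    (iterate ℓ x₁ ε ρ η B (k + 1))
  rw [perturbed, add_sub_cancel_left, norm_smul, Real.norm_of_nonneg (by positivity)] at this
  calc _ ≤ (L * (ρ / √(state ℓ x₁ ε ρ η B (k + 1)).u * ‖gradS ℓ x₁ ε ρ η B (k + 1)‖)) ^ 2 := by
        gcongr; exact this
    _ = _ := by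
        rw [mul_pow, mul_pow, div_pow, Real.sq_sqrt hu.le]; ring

lemma norm_gradG_sub_gradS_sq_le_const (h : LSmooth ℓ L) (hb : 0 < b) (hε : 0 < ε)
    (hρ : 0 ≤ ρ) (k : ℕ) :
    ‖gradG ℓ x₁ ε ρ η B (k + 1) - gradS ℓ x₁ ε ρ η B (k + 1)‖ ^ 2 ≤ L ^ 2 * ρ ^ 2 := by
  have hu : 0 < (state ℓ x₁ ε ρ η B (k + 1)).u := lt_of_lt_of_le (by positivity) (le_state_u B _)
  have h0 : 0 < (state ℓ x₁ ε ρ η B k).u := lt_of_lt_of_le (by positivity) (le_state_u B _)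
  refine (norm_gradG_sub_gradS_sq_le B h hb hε hρ k).trans
    (mul_le_of_le_one_right (by positivity) ?_)
  rw [div_le_one hu, state_u_succ]
  linarith

lemma norm_sq_le_two_mul_add {E : Type*} [SeminormedAddCommGroup E] (x y : E) :
    ‖x‖ ^ 2 ≤ 2 * ‖y‖ ^ 2 + 2 * ‖x - y‖ ^ 2 := by
  have := norm_le_norm_add_norm_sub y x
  rw [norm_sub_rev] at this
  nlinarith [norm_nonneg x, norm_nonneg y, norm_nonneg (x - y), sq_nonneg (‖y‖ - ‖x - y‖)]

/-- The normalized perturbation has length at most `ρ`, so each iteration adds comparable amounts to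
`u` and `v`. Thus control of `v` is enough for both accumulators. -/
lemma state_u_le (h : LSmooth ℓ L) (hb : 0 < b) (hε : 0 < ε) (hρ : 0 ≤ ρ) (k : ℕ) :
    (state ℓ x₁ ε ρ η B k).u ≤ 2 * (state ℓ x₁ ε ρ η B k).v + 2 * (L ^ 2 * ρ ^ 2) * k := by
  induction k with
  | zero => simp only [state, Nat.cast_zero, mul_zero, add_zero]; linarith [sq_nonneg ε]
  | succ k ih =>
    have h1 := norm_sq_le_two_mul_add (gradS ℓ x₁ ε ρ η B (k + 1)) (gradG ℓ x₁ ε ρ η B (k + 1))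
    have h2 := norm_gradG_sub_gradS_sq_le_const (x₁ := x₁) (η := η) B h hb hε hρ k
    rw [norm_sub_rev] at h1
    rw [state_u_succ, state_v_succ]
    push_cast
    linarith

end Run

/-! ### The deterministic one-step inequality -/

section StepInequality

variable {E : Type*} [NormedAddCommGroup E] [InnerProductSpace ℝ E]

lemma inv_sub_inv_eq_of_sq_eq {a b γ : ℝ} (ha : 0 < a) (hb : 0 < b) (hab : b ^ 2 = a ^ 2 + γ ^ 2) :
    1 / a - 1 / b = γ ^ 2 / (a * b * (a + b)) := by
  have : γ ^ 2 = (b - a) * (a + b) := by linarith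
  rw [this]
  field_simp

/-- The error of replacing the current step size `1 / b` by the previous one `1 / a`. -/
lemma inner_mul_inv_sub_inv_le {G g : E} {a b ε P Q : ℝ} (hε : 0 < ε) (ha : ε ≤ a) (hb : 0 < b)
    (hab : b ^ 2 = a ^ 2 + ‖g‖ ^ 2) (hP : 0 < P) (hQ : 0 < Q) :
    ⟪G, g⟫_ℝ * (1 / a - 1 / b) ≤ ‖G‖ ^ 2 * ‖g‖ ^ 2 / (8 * (P + Q * ‖G‖ ^ 2) * a)
      + 2 * P / ε * (‖g‖ ^ 2 / b ^ 2) + 2 * Q * ‖G‖ ^ 2 * (1 / a - 1 / b) := by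
  have ha0 : 0 < a := hε.trans_le ha
  have hgb : ‖g‖ ≤ b := abs_le_of_sq_le_sq' (by nlinarith) hb.le |>.2
  rw [inv_sub_inv_eq_of_sq_eq ha0 hb hab]
  -- The Young weight: the conditional mean of `‖g‖ ^ 2` is at most `M`, so `M` cancels from the
  -- first error term in expectation.
  set M := P + Q * ‖G‖ ^ 2 with hM
  have hM0 : 0 < M := by positivity
  set y := ‖g‖ / (a + b) with hy
  have hy0 : 0 ≤ y := by positivity
  have hba : b ≤ a + b := by linarith
  have h1 : ⟪G, g⟫_ℝ * (‖g‖ ^ 2 / (a * b * (a + b))) ≤ (‖G‖ * ‖g‖) * y / a := by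
    calc _ ≤ (‖G‖ * ‖g‖) * (‖g‖ ^ 2 / (a * b * (a + b))) := by
          gcongr; exact real_inner_le_norm G g
      _ = (‖G‖ * ‖g‖) * y / a * (‖g‖ / b) := by rw [hy]; field_simp
      _ ≤ _ := mul_le_of_le_one_right (by positivity) ((div_le_one hb).2 hgb)
  have h2 : (‖G‖ * ‖g‖) * y ≤ (‖G‖ * ‖g‖) ^ 2 / (8 * M) + 2 * M * y ^ 2 := by
    have : (‖G‖ * ‖g‖) ^ 2 / (8 * M) + 2 * M * y ^ 2 - (‖G‖ * ‖g‖) * y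
        = (‖G‖ * ‖g‖ - 4 * M * y) ^ 2 / (8 * M) := by field_simp; ring
    have h' : 0 ≤ (‖G‖ * ‖g‖ - 4 * M * y) ^ 2 / (8 * M) := by positivity
    linarith
  -- The term `2 * M * y ^ 2 / a` is bounded in two ways: its `P` part by a logarithmic increment
  -- (`h3`), its `Q ‖G‖²` part by the increment of `1 / a` (`h4`), which can telescope.
  have h3 : y ^ 2 / a ≤ 1 / ε * (‖g‖ ^ 2 / b ^ 2) := by
    rw [hy, div_pow, div_eq_mul_one_div _ a, mul_comm]
    gcongr
  have h4 : y ^ 2 / a ≤ ‖g‖ ^ 2 / (a * b * (a + b)) := by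
    rw [hy, div_pow, div_div]
    gcongr _ / ?_
    have : a * b * (a + b) ≤ a * (a + b) * (a + b) := by gcongr
    linarith
  calc _ ≤ (‖G‖ * ‖g‖) * y / a := h1
    _ ≤ ((‖G‖ * ‖g‖) ^ 2 / (8 * M) + 2 * M * y ^ 2) / a := by gcongr
    _ = ‖G‖ ^ 2 * ‖g‖ ^ 2 / (8 * M * a) + 2 * P * (y ^ 2 / a)
        + 2 * Q * ‖G‖ ^ 2 * (y ^ 2 / a) := by rw [hM]; field_simp; ring
    _ ≤ ‖G‖ ^ 2 * ‖g‖ ^ 2 / (8 * M * a) + 2 * P * (1 / ε * (‖g‖ ^ 2 / b ^ 2))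
        + 2 * Q * ‖G‖ ^ 2 * (‖g‖ ^ 2 / (a * b * (a + b))) := by gcongr
    _ = _ := by ring

/-- One iteration of the method decreases the potential `f / η + 2 Q ‖∇f‖² / √v` up to
summable errors. -/
lemma potential_step_le {G G' g s : E} {a b ε P Q L η f f' : ℝ} (hε : 0 < ε) (ha : ε ≤ a)
    (hb : 0 < b) (hab : b ^ 2 = a ^ 2 + ‖g‖ ^ 2) (hP : 0 < P) (hQ : 0 < Q) (hL : 0 ≤ L)
    (hη : 0 < η) (hf : f' ≤ f - η / b * ⟪G, g⟫_ℝ + L * (η / b * ‖g‖) ^ 2)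
    (hG : ‖G' - G‖ ≤ L * (η / b * ‖g‖)) :
    f' / η + 2 * Q * ‖G'‖ ^ 2 / b ≤ f / η + 2 * Q * ‖G‖ ^ 2 / a - ⟪G, s⟫_ℝ / a
      + ‖G‖ ^ 2 / (4 * a) + ‖G‖ ^ 2 * ‖g‖ ^ 2 / (8 * (P + Q * ‖G‖ ^ 2) * a)
      + 2 / ε * ‖g - s‖ ^ 2
      + (L * η + 2 * P / ε + 2 * Q * (1 + 16 * Q) * L ^ 2 * η ^ 2 / ε) * (‖g‖ ^ 2 / b ^ 2) := by
  have ha0 : 0 < a := hε.trans_le ha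
  have hale : a ≤ b := abs_le_of_sq_le_sq' (by nlinarith [sq_nonneg ‖g‖]) hb.le |>.2
  have i0 : f' / η ≤ f / η - ⟪G, g⟫_ℝ / b + L * η * (‖g‖ ^ 2 / b ^ 2) := by
    calc f' / η ≤ (f - η / b * ⟪G, g⟫_ℝ + L * (η / b * ‖g‖) ^ 2) / η := by gcongr
      _ = _ := by field_simp
  -- The main term `⟪G, s⟫ / a` pairs an unbiased gradient with a step size known from the past; the
  -- other two are the perturbation error and the step size error.
  have i1 : - (⟪G, g⟫_ℝ / b) = - (⟪G, s⟫_ℝ / a) - ⟪G, g - s⟫_ℝ / a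
      + ⟪G, g⟫_ℝ * (1 / a - 1 / b) := by rw [inner_sub_right]; ring
  have i2 : - (⟪G, g - s⟫_ℝ / a) ≤ ‖G‖ ^ 2 / (8 * a) + 2 / ε * ‖g - s‖ ^ 2 := by
    have h1 := neg_le_of_abs_le (abs_real_inner_le_norm G (g - s))
    have h2 : ‖G‖ * ‖g - s‖ ≤ ‖G‖ ^ 2 / 8 + 2 * ‖g - s‖ ^ 2 := by
      nlinarith [sq_nonneg (‖G‖ - 4 * ‖g - s‖)]
    calc - (⟪G, g - s⟫_ℝ / a) = (-⟪G, g - s⟫_ℝ) / a := by ring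
      _ ≤ (‖G‖ ^ 2 / 8 + 2 * ‖g - s‖ ^ 2) / a := by gcongr; linarith
      _ = ‖G‖ ^ 2 / (8 * a) + 2 / a * ‖g - s‖ ^ 2 := by ring
      _ ≤ _ := by gcongr
  have i3 := inner_mul_inv_sub_inv_le (G := G) hε ha hb hab hP hQ
  -- Moving the gradient from `G` to `G'` costs another `1 / 8` of the decrease; together with `i2`
  -- this makes the `1 / 4` of the statement.
  have i4 : 2 * Q * ‖G'‖ ^ 2 / b ≤ 2 * Q * ‖G‖ ^ 2 / b + ‖G‖ ^ 2 / (8 * a)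
      + 2 * Q * (1 + 16 * Q) * L ^ 2 * η ^ 2 / ε * (‖g‖ ^ 2 / b ^ 2) := by
    set r := L * (η / b * ‖g‖) with hr
    have hr0 : 0 ≤ r := by positivity
    have h1 : ‖G'‖ ≤ ‖G‖ + r := by
      have := norm_le_norm_add_norm_sub G G'
      rw [norm_sub_rev] at this
      linarith
    have h2 : 2 * Q * ‖G'‖ ^ 2 ≤ 2 * Q * ‖G‖ ^ 2 + ‖G‖ ^ 2 / 8 + 2 * Q * (1 + 16 * Q) * r ^ 2 := by
      calc 2 * Q * ‖G'‖ ^ 2 ≤ 2 * Q * (‖G‖ + r) ^ 2 := by gcongr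
        _ ≤ _ := by nlinarith [sq_nonneg (‖G‖ - 16 * Q * r)]
    calc 2 * Q * ‖G'‖ ^ 2 / b
        ≤ (2 * Q * ‖G‖ ^ 2 + ‖G‖ ^ 2 / 8 + 2 * Q * (1 + 16 * Q) * r ^ 2) / b := by gcongr
      _ = 2 * Q * ‖G‖ ^ 2 / b + ‖G‖ ^ 2 / (8 * b)
          + 2 * Q * (1 + 16 * Q) * L ^ 2 * η ^ 2 / b * (‖g‖ ^ 2 / b ^ 2) := by
        rw [hr]; field_simp
      _ ≤ _ := by
        have := ha.trans hale
        gcongr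
  have i5 : 2 * Q * ‖G‖ ^ 2 * (1 / a - 1 / b) = 2 * Q * ‖G‖ ^ 2 / a - 2 * Q * ‖G‖ ^ 2 / b := by
    ring
  have i6 : ‖G‖ ^ 2 / (4 * a) = ‖G‖ ^ 2 / (8 * a) + ‖G‖ ^ 2 / (8 * a) := by ring
  have i7 : (L * η + 2 * P / ε + 2 * Q * (1 + 16 * Q) * L ^ 2 * η ^ 2 / ε) * (‖g‖ ^ 2 / b ^ 2)
      = L * η * (‖g‖ ^ 2 / b ^ 2) + 2 * P / ε * (‖g‖ ^ 2 / b ^ 2)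
        + 2 * Q * (1 + 16 * Q) * L ^ 2 * η ^ 2 / ε * (‖g‖ ^ 2 / b ^ 2) := by ring
  linarith

end StepInequality

/-! ### Real inequalities and the self-bounding recursion -/

section RealInequalities

lemma sub_div_le_log_sub_log {x y : ℝ} (hx : 0 < x) (hy : 0 < y) :
    (y - x) / y ≤ Real.log y - Real.log x := by
  have := Real.log_le_sub_one_of_pos (div_pos hx hy)
  rw [Real.log_div hx.ne' hy.ne'] at this
  have e : (y - x) / y = 1 - x / y := by field_simp
  linarith

/-- The parameter `δ` stays free because it is used twice: as a constant to close the recursion,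
then of order `T^(-1/2)` to extract a logarithm. The bound is linear in `√z`, so it passes to
expectations. -/
lemma log_le_mul_sqrt_sub {z δ : ℝ} (hz : 0 < z) (hδ : 0 < δ) :
    Real.log (2 * z) ≤ 4 * δ * √z - 2 * Real.log δ := by
  have hs : 0 < √z := Real.sqrt_pos.2 hz
  have h1 := Real.log_le_sub_one_of_pos (mul_pos hδ hs)
  have h2 := Real.log_le_sub_one_of_pos (show (0 : ℝ) < 2 by norm_num)
  rw [Real.log_mul hδ.ne' hs.ne', Real.log_sqrt hz.le] at h1
  rw [Real.log_mul two_ne_zero hz.ne']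
  nlinarith [mul_pos hδ hs]

lemma sqrt_add_sub_sqrt_le {z w : ℝ} (hz : 0 < z) (hw : 0 ≤ w) :
    √(z + w) ≤ √z + w / (2 * √z) := by
  have hs : 0 < √z := Real.sqrt_pos.2 hz
  rw [Real.sqrt_le_left (by positivity)]
  have e : (√z + w / (2 * √z)) ^ 2 = √z ^ 2 + w + (w / (2 * √z)) ^ 2 := by field_simp; ring
  rw [e, Real.sq_sqrt hz.le]
  nlinarith [sq_nonneg (w / (2 * √z))]

lemma div_sqrt_mul_le {P : ℝ} (hP : 0 < P) (k : ℕ) :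
    P / √(P * (k + 1)) ≤ 2 * √P * (√(k + 1) - √k) := by
  have h1 : 0 < √((k : ℝ) + 1) := Real.sqrt_pos.2 (by positivity)
  have hP' : 0 < √P := Real.sqrt_pos.2 hP
  have hk : √(k : ℝ) ≤ √((k : ℝ) + 1) := Real.sqrt_le_sqrt (by linarith)
  have e1 : √((k : ℝ) + 1) ^ 2 = k + 1 := Real.sq_sqrt (by positivity)
  have e2 : √(k : ℝ) ^ 2 = k := Real.sq_sqrt (by positivity)
  have e3 : √P ^ 2 = P := Real.sq_sqrt hP.le
  rw [Real.sqrt_mul hP.le, div_le_iff₀ (by positivity)]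
  have : 1 ≤ 2 * √((k : ℝ) + 1) * (√(k + 1) - √k) := by
    nlinarith [sq_nonneg (√((k : ℝ) + 1) - √k)]
  calc P = √P ^ 2 * 1 := by rw [e3, mul_one]
    _ ≤ √P ^ 2 * (2 * √((k : ℝ) + 1) * (√(k + 1) - √k)) := by gcongr
    _ = _ := by ring

/-- A self-bounding recursion: if `∑ p` grows at most like the logarithm of `W`, and `W` grows at
most like `√k + ∑ p`, then `W = O(√k)`. -/
lemma exists_le_mul_sqrt (A B Q w₀ R : ℝ) (hB : 0 ≤ B) (hQ : 0 < Q) (hw : 0 ≤ w₀) (hR : 0 ≤ R) :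
    ∃ K : ℝ, 0 ≤ K ∧ ∀ (S W : ℝ) (T : ℕ),
      (∀ δ : ℝ, 0 < δ → 5 / 8 * S ≤ A + B * (4 * δ * W - 2 * Real.log δ)) →
      W ≤ w₀ + R * √T + Q * S → W ≤ K * √((T : ℝ) + 1) := by
  set δ : ℝ := 1 / (16 * Q * B + 1) with hδ
  have hδ0 : 0 < δ := by positivity
  set c : ℝ := w₀ + 8 / 5 * Q * (|A| + 2 * B * |Real.log δ|) with hc
  have hc0 : 0 ≤ c := by positivity
  refine ⟨2 * (c + R), by positivity, fun S W T hS hW => ?_⟩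
  by_cases hW0 : W ≤ 0
  · exact hW0.trans (by positivity)
  push Not at hW0
  have h1 := hS δ hδ0
  have h2 : 16 * Q * B * δ ≤ 1 := by
    rw [hδ, mul_one_div, div_le_one (by positivity)]; linarith
  have h3 : Q * S ≤ 8 / 5 * Q * (|A| + 2 * B * |Real.log δ|) + W / 2 := by
    have : S ≤ 8 / 5 * (A + B * (4 * δ * W - 2 * Real.log δ)) := by linarith
    have h4 : Q * S ≤ Q * (8 / 5 * (A + B * (4 * δ * W - 2 * Real.log δ))) := by gcongr
    have h5 : Q * A ≤ Q * |A| := by gcongr; exact le_abs_self A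
    have h6 : Q * B * -Real.log δ ≤ Q * B * |Real.log δ| := by gcongr; exact neg_le_abs _
    have h7 : (16 * Q * B * δ) * W ≤ 1 * W := by gcongr
    linarith
  have hT : √(T : ℝ) ≤ √((T : ℝ) + 1) := Real.sqrt_le_sqrt (by linarith)
  have hT1 : 1 ≤ √((T : ℝ) + 1) := Real.one_le_sqrt.2 (by linarith [T.cast_nonneg (α := ℝ)])
  nlinarith [mul_le_mul_of_nonneg_left hT hR, mul_le_mul_of_nonneg_left hT1 hc0]

/-- Under the bound of `exists_le_mul_sqrt`, the sums of `p` grow at most logarithmically. -/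
lemma le_mul_log {A B K S W : ℝ} {T : ℕ} (hB : 0 ≤ B) (hK : 0 ≤ K) (hT : 2 ≤ T)
    (hS : ∀ δ : ℝ, 0 < δ → 5 / 8 * S ≤ A + B * (4 * δ * W - 2 * Real.log δ))
    (hW : W ≤ K * √((T : ℝ) + 1)) :
    S ≤ 8 / 5 * ((|A| + 4 * B * K) / Real.log 2 + 2 * B) * Real.log T := by
  have hT' : (2 : ℝ) ≤ T := by exact_mod_cast hT
  have hs : 0 < √((T : ℝ) + 1) := Real.sqrt_pos.2 (by positivity)
  have hl2 : 0 < Real.log 2 := Real.log_pos (by norm_num)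
  have hlT : Real.log 2 ≤ Real.log T := Real.log_le_log (by norm_num) hT'
  -- With this `δ` the product `δ * W` is at most `K`, and `-2 * log δ = log (T + 1)`.
  have h1 := hS (1 / √((T : ℝ) + 1)) (by positivity)
  rw [one_div, Real.log_inv, Real.log_sqrt (by positivity)] at h1
  have h2 : (√((T : ℝ) + 1))⁻¹ * W ≤ K := by
    rw [inv_mul_le_iff₀ hs]; linarith
  have h3 : Real.log ((T : ℝ) + 1) ≤ 2 * Real.log T := by
    rw [← Real.log_rpow (by linarith)]
    refine Real.log_le_log (by positivity) ?_
    rw [Real.rpow_two]; nlinarith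
  have h4 : |A| + 4 * B * K ≤ (|A| + 4 * B * K) / Real.log 2 * Real.log T := by
    rw [div_mul_eq_mul_div, le_div_iff₀ hl2]
    gcongr
  have h5 := le_abs_self A
  have h6 := mul_le_mul_of_nonneg_left h2 hB
  have h7 := mul_le_mul_of_nonneg_left h3 hB
  nlinarith

end RealInequalities

/-! ### Functions of finitely many minibatches -/

section FiniteDependence

variable {Ω α : Type*} [Finite α] {ξ : ℕ → Ω → α} {k : ℕ}

lemma finite_range_of_dependsOn {β : Type*} [Nonempty β] {F : (ℕ → α) → β}
    (hF : DependsOn F (Set.Iic k)) : (Set.range fun ω => F fun r => ξ r ω).Finite := by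
  obtain ⟨g, rfl⟩ := dependsOn_iff_exists_comp.1 hF
  refine (Set.finite_range g).subset ?_
  rintro _ ⟨ω, rfl⟩
  exact ⟨_, rfl⟩

/-- Only the finitely many values of `Y` matter, so `φ` need not be measurable. -/
lemma measurable_comp_of_finite_range {Ω β γ : Type*} {m : MeasurableSpace Ω} [MeasurableSpace β]
    [MeasurableSingletonClass β] [MeasurableSpace γ] {Y : Ω → β} (hY : Measurable[m] Y)
    (hfin : (Set.range Y).Finite) (φ : β → γ) : Measurable[m] fun ω => φ (Y ω) := by
  intro s _
  have : (fun ω => φ (Y ω)) ⁻¹' s = Y ⁻¹' (Set.range Y ∩ φ ⁻¹' s) := by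
    ext ω; simp
  rw [this]
  exact hY (hfin.subset Set.inter_subset_left).measurableSet

variable [MeasurableSpace Ω] [MeasurableSpace α] [MeasurableSingletonClass α]

lemma measurable_of_dependsOn {β : Type*} [MeasurableSpace β] [Nonempty β]
    (hξ : ∀ t, Measurable (ξ t)) {F : (ℕ → α) → β}
    (hF : DependsOn F (Set.Iic k)) : Measurable fun ω => F fun r => ξ r ω := by
  obtain ⟨g, rfl⟩ := dependsOn_iff_exists_comp.1 hF
  have h1 : Measurable fun ω => fun i : Set.Iic k => ξ i ω := measurable_pi_lambda _ fun i => hξ i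
  exact (measurable_of_finite g).comp h1

lemma integrable_of_dependsOn {μ : Measure Ω} [IsFiniteMeasure μ]
    (hξ : ∀ t, Measurable (ξ t)) {F : (ℕ → α) → ℝ}
    (hF : DependsOn F (Set.Iic k)) : Integrable (fun ω => F fun r => ξ r ω) μ := by
  obtain ⟨g, rfl⟩ := dependsOn_iff_exists_comp.1 hF
  have h1 : Measurable fun ω => fun i : Set.Iic k => ξ i ω := measurable_pi_lambda _ fun i => hξ i
  exact (Integrable.of_finite (f := g)).comp_measurable h1

end FiniteDependence

/-! ### Conditional bounds against a weight from the past -/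

section ConditionalExpectation

variable {Ω : Type*} {m m₀ : MeasurableSpace Ω} {μ : Measure Ω} [IsFiniteMeasure μ] {N h : Ω → ℝ}
  {c : ℝ}

lemma integral_mul_condExp (hm : m ≤ m₀) (hh : StronglyMeasurable[m] h) (hN : Integrable N μ)
    (hNh : Integrable (fun ω => h ω * N ω) μ) :
    ∫ ω, h ω * N ω ∂μ = ∫ ω, h ω * (μ[N | m]) ω ∂μ := by
  rw [← integral_condExp hm]
  exact integral_congr_ae (condExp_mul_of_stronglyMeasurable_left hh hNh hN)

lemma integral_mul_eq_of_condExp_eq (hm : m ≤ m₀) (hh : StronglyMeasurable[m] h)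
    (hN : Integrable N μ) (hNh : Integrable (fun ω => h ω * N ω) μ)
    (hc : μ[N | m] =ᵐ[μ] fun _ => c) : ∫ ω, h ω * N ω ∂μ = ∫ ω, h ω * c ∂μ := by
  rw [integral_mul_condExp hm hh hN hNh]
  exact integral_congr_ae (hc.mono fun ω hω => by simp only [hω])

lemma integral_mul_le_of_condExp_le (hm : m ≤ m₀) (hh : StronglyMeasurable[m] h)
    (h0 : ∀ ω, 0 ≤ h ω) (hhi : Integrable h μ) (hN : Integrable N μ)
    (hNh : Integrable (fun ω => h ω * N ω) μ) (hc : μ[N | m] ≤ᵐ[μ] fun _ => c) :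
    ∫ ω, h ω * N ω ∂μ ≤ ∫ ω, h ω * c ∂μ := by
  rw [integral_mul_condExp hm hh hN hNh]
  refine integral_mono_ae ?_ (hhi.mul_const c)
    (hc.mono fun ω hω => mul_le_mul_of_nonneg_left hω (h0 ω))
  exact integrable_condExp.congr (condExp_mul_of_stronglyMeasurable_left hh hNh hN)

end ConditionalExpectation

/-! ### Measurability, unbiasedness and variance along a random run -/

section RandomRun

variable {d n b : ℕ} (ℓ : Fin n → EuclideanSpace ℝ (Fin d) → ℝ) (x₁ : EuclideanSpace ℝ (Fin d))
  (ε ρ η : ℝ)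

/-- There are finitely many minibatches, so after `k` iterations a run has finitely many outcomes.
This makes all later integrability claims automatic. -/
lemma dependsOn_state (k : ℕ) :
    DependsOn (fun B : ℕ → Fin b → Fin n => state ℓ x₁ ε ρ η B k) (Set.Iic k) := by
  induction k with
  | zero => intro B B' _; rfl
  | succ k ih =>
    intro B B' h
    have h1 : state ℓ x₁ ε ρ η B k = state ℓ x₁ ε ρ η B' k :=
      ih fun i hi => h i (Set.mem_Iic.2 ((Set.mem_Iic.1 hi).trans k.le_succ))
    simp only [state, h1, h (k + 1) (Set.mem_Iic.2 le_rfl)]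

/-- Every quantity of iteration `k + 1` is a function of the state after iteration `k` and of the
minibatch of iteration `k + 1`. -/
lemma dependsOn_state_batch {β : Type*} (k : ℕ) (φ : State d → (Fin b → Fin n) → β) :
    DependsOn (fun B : ℕ → Fin b → Fin n => φ (state ℓ x₁ ε ρ η B k) (B (k + 1)))
      (Set.Iic (k + 1)) := by
  intro B B' h
  have h1 : state ℓ x₁ ε ρ η B k = state ℓ x₁ ε ρ η B' k := dependsOn_state ℓ x₁ ε ρ η k
    fun i hi => h i (Set.mem_Iic.2 ((Set.mem_Iic.1 hi).trans k.le_succ))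
  simp only [h1, h (k + 1) (Set.mem_Iic.2 le_rfl)]

lemma dependsOn_gradS_gradG {β : Type*} (k : ℕ)
    (φ : State d → State d → EuclideanSpace ℝ (Fin d) → EuclideanSpace ℝ (Fin d) → β) :
    DependsOn (fun B : ℕ → Fin b → Fin n => φ (state ℓ x₁ ε ρ η B k) (state ℓ x₁ ε ρ η B (k + 1))
      (gradS ℓ x₁ ε ρ η B (k + 1)) (gradG ℓ x₁ ε ρ η B (k + 1))) (Set.Iic (k + 1)) :=
  dependsOn_state_batch ℓ x₁ ε ρ η k fun S B => φ S (step ℓ ρ η B S) (gradient (batchLoss ℓ B) S.x)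
    (gradient (batchLoss ℓ B) (S.x + (ρ / √(step ℓ ρ η B S).u) • gradient (batchLoss ℓ B) S.x))

variable {Ω : Type*} {ξ : ℕ → Ω → Fin b → Fin n}

lemma history_mono {k l : ℕ} (h : k ≤ l) :
    history ℓ x₁ ε ρ η ξ k ≤ history ℓ x₁ ε ρ η ξ l :=
  biSup_mono fun _ hi => Finset.Icc_subset_Icc_right h hi

lemma measurable_gradG (k : ℕ) : Measurable[history ℓ x₁ ε ρ η ξ (k + 1)]
    fun ω => gradG ℓ x₁ ε ρ η (fun r => ξ r ω) (k + 1) := by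
  refine Measurable.mono (comap_measurable _) ?_ le_rfl
  exact le_sup_right.trans (le_iSup₂_of_le (k + 1) (Finset.mem_Icc.2 ⟨by omega, le_rfl⟩) le_rfl)

/-- The updates of `x` and `v` involve only the gradients `g`. The accumulator `u` is left out,
since every weight used against a conditional expectation is a function of `x` and `v`. -/
lemma measurable_state (k : ℕ) : Measurable[history ℓ x₁ ε ρ η ξ k]
    fun ω => ((state ℓ x₁ ε ρ η (fun r => ξ r ω) k).x, (state ℓ x₁ ε ρ η (fun r => ξ r ω) k).v) := by
  induction k with
  | zero => simp only [state]; exact measurable_const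
  | succ k ih =>
    let _ : MeasurableSpace Ω := history ℓ x₁ ε ρ η ξ (k + 1)
    have hg := measurable_gradG ℓ x₁ ε ρ η (ξ := ξ) k
    have ih' := ih.mono (history_mono ℓ x₁ ε ρ η k.le_succ) le_rfl
    have hv : Measurable[history ℓ x₁ ε ρ η ξ (k + 1)]
        fun ω => (state ℓ x₁ ε ρ η (fun r => ξ r ω) (k + 1)).v := by
      simp only [state_v_succ]
      exact ih'.snd.add (hg.norm.pow_const 2)
    refine Measurable.prodMk ?_ hv
    simp only [state_x_succ]
    exact ih'.fst.sub ((hv.sqrt.const_div η).smul hg)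

lemma stronglyMeasurable_state (k : ℕ) (φ : EuclideanSpace ℝ (Fin d) → ℝ → ℝ) :
    StronglyMeasurable[history ℓ x₁ ε ρ η ξ k]
      fun ω => φ (state ℓ x₁ ε ρ η (fun r => ξ r ω) k).x (state ℓ x₁ ε ρ η (fun r => ξ r ω) k).v :=
  (measurable_comp_of_finite_range (measurable_state ℓ x₁ ε ρ η (ξ := ξ) k)
    (finite_range_of_dependsOn (k := k) (F := fun B => ((state ℓ x₁ ε ρ η B k).x, (state ℓ x₁ ε ρ η B k).v))
      fun _ _ h => by simp only [dependsOn_state ℓ x₁ ε ρ η k h])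
    (fun p => φ p.1 p.2)).stronglyMeasurable

variable [MeasurableSpace Ω] {μ : Measure Ω}

lemma integrable_iteration [IsFiniteMeasure μ] (hξ : ∀ t, Measurable (ξ t)) (k : ℕ)
    (φ : State d → State d → EuclideanSpace ℝ (Fin d) → EuclideanSpace ℝ (Fin d) → ℝ) :
    Integrable (fun ω => φ (state ℓ x₁ ε ρ η (fun r => ξ r ω) k)
      (state ℓ x₁ ε ρ η (fun r => ξ r ω) (k + 1)) (gradS ℓ x₁ ε ρ η (fun r => ξ r ω) (k + 1))
      (gradG ℓ x₁ ε ρ η (fun r => ξ r ω) (k + 1))) μ :=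
  integrable_of_dependsOn hξ (dependsOn_gradS_gradG ℓ x₁ ε ρ η k φ)

lemma history_le (hξ : ∀ t, Measurable (ξ t)) (k : ℕ) :
    history ℓ x₁ ε ρ η ξ k ≤ ‹MeasurableSpace Ω› := by
  refine iSup₂_le fun i hi => ?_
  obtain ⟨i, rfl⟩ : ∃ j, i = j + 1 := ⟨i - 1, by have := (Finset.mem_Icc.1 hi).1; omega⟩
  refine sup_le ?_ ?_
  · exact (measurable_of_dependsOn hξ
      (dependsOn_gradS_gradG ℓ x₁ ε ρ η i fun _ _ s _ => s)).comap_le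
  · exact (measurable_of_dependsOn hξ
      (dependsOn_gradS_gradG ℓ x₁ ε ρ η i fun _ _ _ g => g)).comap_le

variable {ℓ x₁ ε ρ η} {L D₀ D₁ : ℝ} [IsProbabilityMeasure μ]

lemma UniformSampling.integral_ite_mul (h : UniformSampling μ ℓ x₁ ε ρ η ξ) (k : ℕ) (j : Fin b)
    (i : Fin n) (φ : EuclideanSpace ℝ (Fin d) → ℝ → ℝ) :
    ∫ ω, φ (state ℓ x₁ ε ρ η (fun r => ξ r ω) k).x (state ℓ x₁ ε ρ η (fun r => ξ r ω) k).v
        * (if ξ (k + 1) ω j = i then (1 : ℝ) else 0) ∂μ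
      = ∫ ω, φ (state ℓ x₁ ε ρ η (fun r => ξ r ω) k).x (state ℓ x₁ ε ρ η (fun r => ξ r ω) k).v
        * (1 / (n : ℝ)) ∂μ :=
  integral_mul_eq_of_condExp_eq (history_le ℓ x₁ ε ρ η h.1 k)
    (stronglyMeasurable_state ℓ x₁ ε ρ η k φ)
    (integrable_of_dependsOn h.1 (dependsOn_state_batch ℓ x₁ ε ρ η k
      fun _ B => if B j = i then (1 : ℝ) else 0))
    (integrable_of_dependsOn h.1 (dependsOn_state_batch ℓ x₁ ε ρ η k
      fun S B => φ S.x S.v * if B j = i then (1 : ℝ) else 0)) (h.2 k j i)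

/-- Unbiasedness of the first stochastic gradient. -/
lemma UniformSampling.integral_inner_gradS (h : UniformSampling μ ℓ x₁ ε ρ η ξ) (hb : 0 < b)
    (hℓ : LSmooth ℓ L) (k : ℕ) (ψ : ℝ → ℝ) :
    ∫ ω, ⟪gradient (risk ℓ) (state ℓ x₁ ε ρ η (fun r => ξ r ω) k).x,
        gradS ℓ x₁ ε ρ η (fun r => ξ r ω) (k + 1)⟫_ℝ / ψ (state ℓ x₁ ε ρ η (fun r => ξ r ω) k).v ∂μ
      = ∫ ω, ‖gradient (risk ℓ) (state ℓ x₁ ε ρ η (fun r => ξ r ω) k).x‖ ^ 2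
        / ψ (state ℓ x₁ ε ρ η (fun r => ξ r ω) k).v ∂μ := by
  have hb' : (b : ℝ) ≠ 0 := by exact_mod_cast hb.ne'
  set φ : Fin n → EuclideanSpace ℝ (Fin d) → ℝ → ℝ := fun i x v =>
    ⟪gradient (risk ℓ) x, gradient (ℓ i) x⟫_ℝ / ψ v with hφ
  -- The minibatch gradient is expanded into indicators of the events "index `j` equals `i`". By
  -- linearity only the law of each single index enters, so dependence inside a minibatch is
  -- harmless.
  have e1 : ∀ ω, ⟪gradient (risk ℓ) (state ℓ x₁ ε ρ η (fun r => ξ r ω) k).x,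
        gradS ℓ x₁ ε ρ η (fun r => ξ r ω) (k + 1)⟫_ℝ / ψ (state ℓ x₁ ε ρ η (fun r => ξ r ω) k).v
      = (1 / (b : ℝ)) * ∑ j, ∑ i, φ i (state ℓ x₁ ε ρ η (fun r => ξ r ω) k).x
          (state ℓ x₁ ε ρ η (fun r => ξ r ω) k).v
        * (if ξ (k + 1) ω j = i then (1 : ℝ) else 0) := fun ω => by
    rw [gradS, hℓ.gradient_batchLoss, real_inner_smul_right, inner_sum]
    simp only [mul_ite, mul_one, mul_zero, Finset.sum_ite_eq, Finset.mem_univ, if_true]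
    rw [mul_div_assoc, Finset.sum_div]
    rfl
  have e2 : ∀ ω, ‖gradient (risk ℓ) (state ℓ x₁ ε ρ η (fun r => ξ r ω) k).x‖ ^ 2
        / ψ (state ℓ x₁ ε ρ η (fun r => ξ r ω) k).v
      = (1 / (b : ℝ)) * ∑ _j : Fin b, ∑ i, φ i (state ℓ x₁ ε ρ η (fun r => ξ r ω) k).x
          (state ℓ x₁ ε ρ η (fun r => ξ r ω) k).v * (1 / (n : ℝ)) := fun ω => by
    rw [← real_inner_self_eq_norm_sq]
    nth_rewrite 2 [hℓ.gradient_risk]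
    rw [real_inner_smul_right, inner_sum, Finset.sum_const, Finset.card_univ, Fintype.card_fin,
      nsmul_eq_mul, ← mul_assoc, one_div_mul_cancel hb', one_mul, ← Finset.sum_mul, hφ,
      ← Finset.sum_div]
    ring
  simp only [e1, e2]
  rw [integral_const_mul, integral_const_mul, integral_finsetSum, integral_finsetSum]
  · congr 1
    refine Finset.sum_congr rfl fun j _ => ?_
    rw [integral_finsetSum, integral_finsetSum]
    · exact Finset.sum_congr rfl fun i _ => h.integral_ite_mul k j i (φ i)
    · intro i _
      exact integrable_iteration ℓ x₁ ε ρ η h.1 k fun S _ _ _ => φ i S.x S.v * (1 / (n : ℝ))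
    · intro i _
      exact integrable_of_dependsOn h.1 (dependsOn_state_batch ℓ x₁ ε ρ η k
        fun S B => φ i S.x S.v * if B j = i then (1 : ℝ) else 0)
  · intro j _
    exact integrable_iteration ℓ x₁ ε ρ η h.1 k fun S _ _ _ => ∑ i, φ i S.x S.v * (1 / (n : ℝ))
  · intro j _
    exact integrable_of_dependsOn h.1 (dependsOn_state_batch ℓ x₁ ε ρ η k
      fun S B => ∑ i, φ i S.x S.v * if B j = i then (1 : ℝ) else 0)

/-- The affine variance bound at the random point `x_t`, against a weight from the past. -/
lemma AffineVariance.integral_mul_norm_gradS_sq_le (h : AffineVariance μ ℓ x₁ ε ρ η ξ D₀ D₁)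
    (hξ : ∀ t, Measurable (ξ t)) (k : ℕ) (ψ : EuclideanSpace ℝ (Fin d) → ℝ → ℝ)
    (hψ : ∀ x v, 0 ≤ ψ x v) :
    ∫ ω, ψ (state ℓ x₁ ε ρ η (fun r => ξ r ω) k).x (state ℓ x₁ ε ρ η (fun r => ξ r ω) k).v
        * ‖gradS ℓ x₁ ε ρ η (fun r => ξ r ω) (k + 1)‖ ^ 2 ∂μ
      ≤ ∫ ω, ψ (state ℓ x₁ ε ρ η (fun r => ξ r ω) k).x (state ℓ x₁ ε ρ η (fun r => ξ r ω) k).v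
        * (D₀ + D₁ * ‖gradient (risk ℓ) (state ℓ x₁ ε ρ η (fun r => ξ r ω) k).x‖ ^ 2) ∂μ := by
  classical
  -- The hypothesis concerns fixed points `x`. As the iterate takes finitely many values, it is
  -- applied at each value `y`, weighted by the indicator of the past event that the iterate equals
  -- `y`.
  have hfin : (Set.range fun ω => (state ℓ x₁ ε ρ η (fun r => ξ r ω) k).x).Finite :=
    finite_range_of_dependsOn (k := k) (F := fun B => (state ℓ x₁ ε ρ η B k).x)
      fun _ _ h => by simp only [dependsOn_state ℓ x₁ ε ρ η k h]
  set R := hfin.toFinset with hR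
  have hmem : ∀ ω, (state ℓ x₁ ε ρ η (fun r => ξ r ω) k).x ∈ R := fun ω => by simp [hR]
  set φ : EuclideanSpace ℝ (Fin d) → EuclideanSpace ℝ (Fin d) → ℝ → ℝ := fun y x v =>
    if x = y then ψ x v else 0 with hφ
  have e1 : ∀ ω, ψ (state ℓ x₁ ε ρ η (fun r => ξ r ω) k).x
        (state ℓ x₁ ε ρ η (fun r => ξ r ω) k).v
        * ‖gradS ℓ x₁ ε ρ η (fun r => ξ r ω) (k + 1)‖ ^ 2
      = ∑ y ∈ R, φ y (state ℓ x₁ ε ρ η (fun r => ξ r ω) k).x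
          (state ℓ x₁ ε ρ η (fun r => ξ r ω) k).v
        * ‖gradient (batchLoss ℓ (ξ (k + 1) ω)) y‖ ^ 2 := fun ω => by
    simp only [hφ, ite_mul, zero_mul, Finset.sum_ite_eq, hmem ω, if_true]
    rfl
  have e2 : ∀ ω, ψ (state ℓ x₁ ε ρ η (fun r => ξ r ω) k).x
        (state ℓ x₁ ε ρ η (fun r => ξ r ω) k).v
        * (D₀ + D₁ * ‖gradient (risk ℓ) (state ℓ x₁ ε ρ η (fun r => ξ r ω) k).x‖ ^ 2)
      = ∑ y ∈ R, φ y (state ℓ x₁ ε ρ η (fun r => ξ r ω) k).x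
          (state ℓ x₁ ε ρ η (fun r => ξ r ω) k).v
        * (D₀ + D₁ * ‖gradient (risk ℓ) y‖ ^ 2) := fun ω => by
    simp only [hφ, ite_mul, zero_mul, Finset.sum_ite_eq, hmem ω, if_true]
  have i1 : ∀ y, Integrable (fun ω => φ y (state ℓ x₁ ε ρ η (fun r => ξ r ω) k).x
      (state ℓ x₁ ε ρ η (fun r => ξ r ω) k).v
        * ‖gradient (batchLoss ℓ (ξ (k + 1) ω)) y‖ ^ 2) μ := fun y =>
    integrable_of_dependsOn hξ (dependsOn_state_batch ℓ x₁ ε ρ η k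
      fun S B => φ y S.x S.v * ‖gradient (batchLoss ℓ B) y‖ ^ 2)
  have i2 : ∀ y, Integrable (fun ω => φ y (state ℓ x₁ ε ρ η (fun r => ξ r ω) k).x
      (state ℓ x₁ ε ρ η (fun r => ξ r ω) k).v) μ := fun y =>
    integrable_iteration ℓ x₁ ε ρ η hξ k fun S _ _ _ => φ y S.x S.v
  simp only [e1, e2]
  rw [integral_finsetSum _ fun y _ => i1 y, integral_finsetSum _ fun y _ => (i2 y).mul_const _]
  refine Finset.sum_le_sum fun y _ => ?_
  refine integral_mul_le_of_condExp_le (history_le ℓ x₁ ε ρ η hξ k)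
    (stronglyMeasurable_state ℓ x₁ ε ρ η k (φ y)) (fun ω => ?_) (i2 y) ?_ (i1 y) (h k y)
  · simp only [hφ]
    split_ifs
    exacts [hψ _ _, le_rfl]
  · exact integrable_of_dependsOn hξ (dependsOn_state_batch ℓ x₁ ε ρ η k
      fun _ B => ‖gradient (batchLoss ℓ B) y‖ ^ 2)

/-- The affine variance bound for the second stochastic gradient. -/
lemma AffineVariance.integral_mul_norm_gradG_sq_le (h : AffineVariance μ ℓ x₁ ε ρ η ξ D₀ D₁)
    (hξ : ∀ t, Measurable (ξ t)) (hℓ : LSmooth ℓ L) (hb : 0 < b) (hε : 0 < ε) (hρ : 0 ≤ ρ)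
    (k : ℕ) (ψ : EuclideanSpace ℝ (Fin d) → ℝ → ℝ) (hψ : ∀ x v, 0 ≤ ψ x v) :
    ∫ ω, ψ (state ℓ x₁ ε ρ η (fun r => ξ r ω) k).x (state ℓ x₁ ε ρ η (fun r => ξ r ω) k).v
        * ‖gradG ℓ x₁ ε ρ η (fun r => ξ r ω) (k + 1)‖ ^ 2 ∂μ
      ≤ ∫ ω, ψ (state ℓ x₁ ε ρ η (fun r => ξ r ω) k).x (state ℓ x₁ ε ρ η (fun r => ξ r ω) k).v
        * (2 * D₀ + 2 * (L ^ 2 * ρ ^ 2)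
          + 2 * D₁ * ‖gradient (risk ℓ) (state ℓ x₁ ε ρ η (fun r => ξ r ω) k).x‖ ^ 2) ∂μ := by
  have i1 := integrable_iteration (μ := μ) ℓ x₁ ε ρ η hξ k fun S _ _ _ => ψ S.x S.v
  have i2 := integrable_iteration (μ := μ) ℓ x₁ ε ρ η hξ k fun S _ s _ => ψ S.x S.v * ‖s‖ ^ 2
  have i3 := integrable_iteration (μ := μ) ℓ x₁ ε ρ η hξ k fun S _ _ g => ψ S.x S.v * ‖g‖ ^ 2
  have i4 := integrable_iteration (μ := μ) ℓ x₁ ε ρ η hξ k fun S _ _ _ =>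
    ψ S.x S.v * (D₀ + D₁ * ‖gradient (risk ℓ) S.x‖ ^ 2)
  calc _ ≤ ∫ ω, (2 * (ψ (state ℓ x₁ ε ρ η (fun r => ξ r ω) k).x
            (state ℓ x₁ ε ρ η (fun r => ξ r ω) k).v
            * ‖gradS ℓ x₁ ε ρ η (fun r => ξ r ω) (k + 1)‖ ^ 2)
          + 2 * (L ^ 2 * ρ ^ 2) * ψ (state ℓ x₁ ε ρ η (fun r => ξ r ω) k).x
            (state ℓ x₁ ε ρ η (fun r => ξ r ω) k).v) ∂μ := by
        refine integral_mono i3 ((i2.const_mul 2).add (i1.const_mul _)) fun ω => ?_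
        have h1 := norm_sq_le_two_mul_add (gradG ℓ x₁ ε ρ η (fun r => ξ r ω) (k + 1))
          (gradS ℓ x₁ ε ρ η (fun r => ξ r ω) (k + 1))
        have h2 := norm_gradG_sub_gradS_sq_le_const (x₁ := x₁) (η := η) (fun r => ξ r ω) hℓ hb hε
          hρ k
        have h3 : ‖gradG ℓ x₁ ε ρ η (fun r => ξ r ω) (k + 1)‖ ^ 2
          ≤ 2 * ‖gradS ℓ x₁ ε ρ η (fun r => ξ r ω) (k + 1)‖ ^ 2 + 2 * (L ^ 2 * ρ ^ 2) := by linarith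
        have := mul_le_mul_of_nonneg_left h3 (hψ (state ℓ x₁ ε ρ η (fun r => ξ r ω) k).x
            (state ℓ x₁ ε ρ η (fun r => ξ r ω) k).v)
        simp only
        linarith
    _ ≤ _ := by
        rw [integral_add (i2.const_mul 2) (i1.const_mul _), integral_const_mul]
        have := mul_le_mul_of_nonneg_left (h.integral_mul_norm_gradS_sq_le hξ k ψ hψ) zero_le_two
        refine (add_le_add_left this _).trans ?_
        rw [← integral_const_mul, ← integral_add (i4.const_mul 2) (i1.const_mul _)]
        refine le_of_eq (integral_congr_ae (ae_of_all _ fun ω => ?_))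
        simp only
        ring

end RandomRun

/-! ### One-step inequalities in expectation -/

section Expectation

variable {d n b : ℕ} {ℓ : Fin n → EuclideanSpace ℝ (Fin d) → ℝ} {x₁ : EuclideanSpace ℝ (Fin d)}
  {L D₀ D₁ ε ρ η : ℝ} {Ω : Type*} [MeasurableSpace Ω] {μ : Measure Ω} [IsProbabilityMeasure μ]
  {ξ : ℕ → Ω → Fin b → Fin n}

/-- The squared gradient of the objective, weighted by the step size of the previous iteration. -/
def gradTerm (ℓ : Fin n → EuclideanSpace ℝ (Fin d) → ℝ) (S : State d) : ℝ :=
  ‖gradient (risk ℓ) S.x‖ ^ 2 / √S.v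

/-- The Lyapunov function of the method. -/
def potential (ℓ : Fin n → EuclideanSpace ℝ (Fin d) → ℝ) (η Q : ℝ) (S : State d) : ℝ :=
  risk ℓ S.x / η + 2 * Q * ‖gradient (risk ℓ) S.x‖ ^ 2 / √S.v

lemma sqrt_state_v_ge (B : ℕ → Fin b → Fin n) (k : ℕ) :
    ε ≤ √(state ℓ x₁ ε ρ η B k).v :=
  Real.le_sqrt_of_sq_le (le_state_v B k)

lemma potential_succ_le (hℓ : LSmooth ℓ L) (hn : 0 < n) (hb : 0 < b) (hL : 0 ≤ L) (hε : 0 < ε)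
    (hρ : 0 ≤ ρ) (hη : 0 < η) {P Q : ℝ} (hP : 0 < P) (hQ : 0 < Q) (B : ℕ → Fin b → Fin n) (k : ℕ) :
    potential ℓ η Q (state ℓ x₁ ε ρ η B (k + 1)) ≤ potential ℓ η Q (state ℓ x₁ ε ρ η B k)
      - ⟪gradient (risk ℓ) (state ℓ x₁ ε ρ η B k).x, gradS ℓ x₁ ε ρ η B (k + 1)⟫_ℝ
        / √(state ℓ x₁ ε ρ η B k).v
      + 1 / 4 * gradTerm ℓ (state ℓ x₁ ε ρ η B k)
      + ‖gradient (risk ℓ) (state ℓ x₁ ε ρ η B k).x‖ ^ 2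
        / (8 * (P + Q * ‖gradient (risk ℓ) (state ℓ x₁ ε ρ η B k).x‖ ^ 2)
          * √(state ℓ x₁ ε ρ η B k).v) * ‖gradG ℓ x₁ ε ρ η B (k + 1)‖ ^ 2
      + (L * η + 2 * P / ε + 2 * Q * (1 + 16 * Q) * L ^ 2 * η ^ 2 / ε)
        * (Real.log (state ℓ x₁ ε ρ η B (k + 1)).v - Real.log (state ℓ x₁ ε ρ η B k).v)
      + 2 / ε * (L ^ 2 * ρ ^ 2)
        * (Real.log (state ℓ x₁ ε ρ η B (k + 1)).u - Real.log (state ℓ x₁ ε ρ η B k).u) := by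
  set S := state ℓ x₁ ε ρ η B k with hS
  set S' := state ℓ x₁ ε ρ η B (k + 1) with hS'
  set g := gradG ℓ x₁ ε ρ η B (k + 1) with hg
  set s := gradS ℓ x₁ ε ρ η B (k + 1) with hs
  have hε2 : 0 < ε ^ 2 := by positivity
  have hv : 0 < S.v := hε2.trans_le (le_state_v B k)
  have hv' : 0 < S'.v := hε2.trans_le (le_state_v B (k + 1))
  have hu : 0 < S.u := hε2.trans_le (le_state_u B k)
  have hu' : 0 < S'.u := hε2.trans_le (le_state_u B (k + 1))
  have hb0 : 0 < √S'.v := Real.sqrt_pos.2 hv'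
  have ev : S'.v = S.v + ‖g‖ ^ 2 := state_v_succ B k
  have eu : S'.u = S.u + ‖s‖ ^ 2 := state_u_succ B k
  have ex : S'.x - S.x = - ((η / √S'.v) • g) := by rw [state_x_succ]; abel
  have enorm : ‖S'.x - S.x‖ = η / √S'.v * ‖g‖ := by
    rw [ex, norm_neg, norm_smul, Real.norm_of_nonneg (by positivity)]
  have hab : √S'.v ^ 2 = √S.v ^ 2 + ‖g‖ ^ 2 := by
    rw [Real.sq_sqrt hv'.le, Real.sq_sqrt hv.le, ev]
  have hf := hℓ.risk_le hL hn S.x S'.x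
  rw [enorm, ex, inner_neg_right, real_inner_smul_right, ← sub_eq_add_neg] at hf
  have hG := hℓ.norm_gradient_risk_sub_le hn S'.x S.x
  rw [enorm] at hG
  have key := potential_step_le (s := s) hε (sqrt_state_v_ge B k) hb0 hab hP hQ hL hη hf hG
  have l1 := sub_div_le_log_sub_log hv hv'
  have l2 := sub_div_le_log_sub_log hu hu'
  rw [ev, add_sub_cancel_left, ← ev] at l1
  rw [eu, add_sub_cancel_left, ← eu] at l2
  rw [Real.sq_sqrt hv'.le] at key
  have l3 := norm_gradG_sub_gradS_sq_le (x₁ := x₁) (η := η) B hℓ hb hε hρ k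
  have l4 : 2 / ε * ‖g - s‖ ^ 2 ≤ 2 / ε * (L ^ 2 * ρ ^ 2) * (Real.log S'.u - Real.log S.u) := by
    calc _ ≤ 2 / ε * (L ^ 2 * ρ ^ 2 * (‖s‖ ^ 2 / S'.u)) := by gcongr
      _ = 2 / ε * (L ^ 2 * ρ ^ 2) * (‖s‖ ^ 2 / S'.u) := by ring
      _ ≤ _ := by gcongr
  have l5 := mul_le_mul_of_nonneg_left l1 (show 0 ≤ L * η + 2 * P / ε
    + 2 * Q * (1 + 16 * Q) * L ^ 2 * η ^ 2 / ε by positivity)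
  have e1 : ‖gradient (risk ℓ) S.x‖ ^ 2 / (4 * √S.v) = 1 / 4 * gradTerm ℓ S := by
    rw [gradTerm]; ring
  have e2 : ‖gradient (risk ℓ) S.x‖ ^ 2 * ‖g‖ ^ 2
        / (8 * (P + Q * ‖gradient (risk ℓ) S.x‖ ^ 2) * √S.v)
      = ‖gradient (risk ℓ) S.x‖ ^ 2 / (8 * (P + Q * ‖gradient (risk ℓ) S.x‖ ^ 2) * √S.v)
        * ‖g‖ ^ 2 := by ring
  rw [e1, e2] at key
  simp only [potential]
  linarith

/-- Unbiasedness yields one full `gradTerm`; the pathwise errors use `1 / 4` of it and the variance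
term `1 / 8`, leaving `5 / 8`. -/
lemma integral_potential_succ_le (hξ : UniformSampling μ ℓ x₁ ε ρ η ξ)
    (hvar : AffineVariance μ ℓ x₁ ε ρ η ξ D₀ D₁) (hℓ : LSmooth ℓ L) (hn : 0 < n) (hb : 0 < b)
    (hL : 0 ≤ L) (hD₀ : 0 < D₀) (hD₁ : 0 < D₁) (hε : 0 < ε) (hρ : 0 ≤ ρ) (hη : 0 < η) {P Q : ℝ}
    (hP : P = 2 * D₀ + 2 * (L ^ 2 * ρ ^ 2)) (hQ : Q = 2 * D₁) (k : ℕ) :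
    ∫ ω, potential ℓ η Q (state ℓ x₁ ε ρ η (fun r => ξ r ω) (k + 1)) ∂μ
      + 5 / 8 * ∫ ω, gradTerm ℓ (state ℓ x₁ ε ρ η (fun r => ξ r ω) k) ∂μ
    ≤ ∫ ω, potential ℓ η Q (state ℓ x₁ ε ρ η (fun r => ξ r ω) k) ∂μ
      + (L * η + 2 * P / ε + 2 * Q * (1 + 16 * Q) * L ^ 2 * η ^ 2 / ε)
        * (∫ ω, Real.log (state ℓ x₁ ε ρ η (fun r => ξ r ω) (k + 1)).v ∂μ
          - ∫ ω, Real.log (state ℓ x₁ ε ρ η (fun r => ξ r ω) k).v ∂μ)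
      + 2 / ε * (L ^ 2 * ρ ^ 2)
        * (∫ ω, Real.log (state ℓ x₁ ε ρ η (fun r => ξ r ω) (k + 1)).u ∂μ
          - ∫ ω, Real.log (state ℓ x₁ ε ρ η (fun r => ξ r ω) k).u ∂μ) := by
  have hP0 : 0 < P := by rw [hP]; positivity
  have hQ0 : 0 < Q := by rw [hQ]; positivity
  have I := integrable_iteration (μ := μ) ℓ x₁ ε ρ η hξ.1 k
  have i0 := I fun _ S' _ _ => potential ℓ η Q S'
  have i1 := I fun S _ _ _ => potential ℓ η Q S
  have i2 := I fun S _ s _ => ⟪gradient (risk ℓ) S.x, s⟫_ℝ / √S.v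
  have i3 := I fun S _ _ _ => gradTerm ℓ S
  have i4 := I fun S _ _ g => ‖gradient (risk ℓ) S.x‖ ^ 2
    / (8 * (P + Q * ‖gradient (risk ℓ) S.x‖ ^ 2) * √S.v) * ‖g‖ ^ 2
  have i5 := I fun _ S' _ _ => Real.log S'.v
  have i6 := I fun S _ _ _ => Real.log S.v
  have i7 := I fun _ S' _ _ => Real.log S'.u
  have i8 := I fun S _ _ _ => Real.log S.u
  have j1 := i1.sub i2
  have j2 := j1.add (i3.const_mul (1 / 4))
  have j3 := j2.add i4
  have j4 := j3.add ((i5.sub i6).const_mul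
    (L * η + 2 * P / ε + 2 * Q * (1 + 16 * Q) * L ^ 2 * η ^ 2 / ε))
  have j5 := j4.add ((i7.sub i8).const_mul (2 / ε * (L ^ 2 * ρ ^ 2)))
  have key := integral_mono i0 j5 fun ω =>
    potential_succ_le hℓ hn hb hL hε hρ hη hP0 hQ0 (fun r => ξ r ω) k
  rw [integral_add' j4 ((i7.sub i8).const_mul _), integral_add' j3 ((i5.sub i6).const_mul _),
    integral_add' j2 i4, integral_add' j1 (i3.const_mul _), integral_sub' i1 i2,
    integral_const_mul, integral_const_mul, integral_const_mul] at key
  simp only [Pi.sub_apply] at key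
  rw [integral_sub i5 i6, integral_sub i7 i8,
    hξ.integral_inner_gradS hb hℓ k fun v => √v] at key
  have hg := hvar.integral_mul_norm_gradG_sq_le hξ.1 hℓ hb hε hρ k
    (fun x v => ‖gradient (risk ℓ) x‖ ^ 2 / (8 * (P + Q * ‖gradient (risk ℓ) x‖ ^ 2) * √v))
    (fun x v => by positivity)
  have e1 : ∀ ω, ‖gradient (risk ℓ) (state ℓ x₁ ε ρ η (fun r => ξ r ω) k).x‖ ^ 2
      / (8 * (P + Q * ‖gradient (risk ℓ) (state ℓ x₁ ε ρ η (fun r => ξ r ω) k).x‖ ^ 2)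
        * √(state ℓ x₁ ε ρ η (fun r => ξ r ω) k).v)
      * (2 * D₀ + 2 * (L ^ 2 * ρ ^ 2)
        + 2 * D₁ * ‖gradient (risk ℓ) (state ℓ x₁ ε ρ η (fun r => ξ r ω) k).x‖ ^ 2)
      = 1 / 8 * gradTerm ℓ (state ℓ x₁ ε ρ η (fun r => ξ r ω) k) := fun ω => by
    have hv : 0 < √(state ℓ x₁ ε ρ η (fun r => ξ r ω) k).v :=
      hε.trans_le (sqrt_state_v_ge _ k)
    rw [← hP, ← hQ, gradTerm]
    field_simp
  simp only [e1] at hg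
  rw [integral_const_mul] at hg
  have e2 : ∫ ω, ‖gradient (risk ℓ) (state ℓ x₁ ε ρ η (fun r => ξ r ω) k).x‖ ^ 2
      / √(state ℓ x₁ ε ρ η (fun r => ξ r ω) k).v ∂μ
      = ∫ ω, gradTerm ℓ (state ℓ x₁ ε ρ η (fun r => ξ r ω) k) ∂μ := rfl
  rw [e2] at key
  linarith

/-- The shift `P * (k + 1)` keeps the root at least `√(P * (k + 1))`, so the constant part of the
variance contributes a deterministic `O(√T)` in total. The gradient part is paid for by `gradTerm`.
-/
lemma integral_sqrt_succ_le (hξ : ∀ t, Measurable (ξ t))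
    (hvar : AffineVariance μ ℓ x₁ ε ρ η ξ D₀ D₁) (hℓ : LSmooth ℓ L) (hb : 0 < b)
    (hD₀ : 0 < D₀) (hD₁ : 0 < D₁) (hε : 0 < ε) (hρ : 0 ≤ ρ) {P Q : ℝ}
    (hP : P = 2 * D₀ + 2 * (L ^ 2 * ρ ^ 2)) (hQ : Q = 2 * D₁) (k : ℕ) :
    ∫ ω, √((state ℓ x₁ ε ρ η (fun r => ξ r ω) (k + 1)).v + P * ((k + 1 : ℕ) + 1)) ∂μ
    ≤ ∫ ω, √((state ℓ x₁ ε ρ η (fun r => ξ r ω) k).v + P * (k + 1)) ∂μ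
      + 2 * √P * (√((k + 1 : ℕ) : ℝ) - √k)
      + Q * ∫ ω, gradTerm ℓ (state ℓ x₁ ε ρ η (fun r => ξ r ω) k) ∂μ := by
  have hP0 : 0 < P := by rw [hP]; positivity
  have hQ0 : 0 < Q := by rw [hQ]; positivity
  have I := integrable_iteration (μ := μ) ℓ x₁ ε ρ η hξ k
  have i0 := I fun _ S' _ _ => √(S'.v + P * ((k + 1 : ℕ) + 1))
  have i1 := I fun S _ _ _ => √(S.v + P * (k + 1))
  have i2 := I fun S _ _ g => 1 / (2 * √(S.v + P * (k + 1))) * ‖g‖ ^ 2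
  have i3 := I fun S _ _ _ => P / (2 * √(S.v + P * (k + 1)))
  have i4 := I fun S _ _ _ => gradTerm ℓ S
  have i5 := I fun S _ _ _ => 1 / (2 * √(S.v + P * (k + 1)))
    * (P + Q * ‖gradient (risk ℓ) S.x‖ ^ 2)
  have j1 := i1.add i2
  have hv : ∀ ω, 0 < (state ℓ x₁ ε ρ η (fun r => ξ r ω) k).v := fun ω =>
    lt_of_lt_of_le (by positivity) (le_state_v _ k)
  have key := integral_mono i0 (j1.add i3) fun ω => by
    have hz : 0 < (state ℓ x₁ ε ρ η (fun r => ξ r ω) k).v + P * (k + 1) := by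
      have := hv ω
      positivity
    -- The extra `P` in the increment accounts for the growth of the shift from one iteration to the
    -- next.
    have := sqrt_add_sub_sqrt_le hz
      (w := ‖gradG ℓ x₁ ε ρ η (fun r => ξ r ω) (k + 1)‖ ^ 2 + P) (by positivity)
    simp only [Pi.add_apply, state_v_succ]
    refine le_trans (le_of_eq ?_) (this.trans (le_of_eq ?_))
    · congr 1; push_cast; ring
    · ring
  rw [integral_add' j1 i3, integral_add' i1 i2] at key
  have hg := hvar.integral_mul_norm_gradG_sq_le hξ hℓ hb hε hρ k
    (fun _ v => 1 / (2 * √(v + P * (k + 1)))) (fun x v => by positivity)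
  rw [← hP, ← hQ] at hg
  have hlast : ∫ ω, 1 / (2 * √((state ℓ x₁ ε ρ η (fun r => ξ r ω) k).v + P * (k + 1)))
        * (P + Q * ‖gradient (risk ℓ) (state ℓ x₁ ε ρ η (fun r => ξ r ω) k).x‖ ^ 2) ∂μ
      + ∫ ω, P / (2 * √((state ℓ x₁ ε ρ η (fun r => ξ r ω) k).v + P * (k + 1))) ∂μ
      ≤ ∫ ω, (2 * √P * (√((k + 1 : ℕ) : ℝ) - √k)
        + Q * gradTerm ℓ (state ℓ x₁ ε ρ η (fun r => ξ r ω) k)) ∂μ := by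
    rw [← integral_add i5 i3]
    refine integral_mono (i5.add i3) ((integrable_const _).add (i4.const_mul Q)) fun ω => ?_
    set S := state ℓ x₁ ε ρ η (fun r => ξ r ω) k with hS
    have hvω : 0 < S.v := hv ω
    have hs : 0 < √S.v := Real.sqrt_pos.2 hvω
    have hPk : 0 < P * (k + 1) := by positivity
    have hs1 : 0 < √(P * ((k : ℝ) + 1)) := Real.sqrt_pos.2 hPk
    have h1 := div_sqrt_mul_le hP0 k
    have h2 : √(P * ((k : ℝ) + 1)) ≤ √(S.v + P * (k + 1)) := Real.sqrt_le_sqrt (by linarith)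
    have h3 : √S.v ≤ √(S.v + P * (k + 1)) := Real.sqrt_le_sqrt (by linarith)
    set z := √(S.v + P * (k + 1)) with hz
    have hz0 : 0 < z := hs.trans_le h3
    have h4 : P / z ≤ P / √(P * ((k : ℝ) + 1)) := by gcongr
    have h5 : ‖gradient (risk ℓ) S.x‖ ^ 2 / z ≤ gradTerm ℓ S := by rw [gradTerm]; gcongr
    have h6 : 0 ≤ gradTerm ℓ S := by rw [gradTerm]; positivity
    have e : 1 / (2 * z) * (P + Q * ‖gradient (risk ℓ) S.x‖ ^ 2) + P / (2 * z)
        = P / z + Q / 2 * (‖gradient (risk ℓ) S.x‖ ^ 2 / z) := by field_simp; ring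
    push_cast
    rw [e]
    have h7 := mul_le_mul_of_nonneg_left h5 (show 0 ≤ Q / 2 by positivity)
    have h8 := mul_nonneg hQ0.le h6
    linarith
  rw [integral_add (integrable_const _) (i4.const_mul Q)] at hlast
  simp only [integral_const, probReal_univ, one_smul] at hlast
  rw [integral_const_mul] at hlast
  linarith

lemma integral_log_state_le (hξ : ∀ t, Measurable (ξ t)) (hℓ : LSmooth ℓ L) (hb : 0 < b)
    (hD₀ : 0 < D₀) (hε : 0 < ε) (hρ : 0 ≤ ρ) {P : ℝ}
    (hP : P = 2 * D₀ + 2 * (L ^ 2 * ρ ^ 2)) (k : ℕ) {δ : ℝ} (hδ : 0 < δ) :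
    ∫ ω, Real.log (state ℓ x₁ ε ρ η (fun r => ξ r ω) k).v ∂μ
        ≤ 4 * δ * ∫ ω, √((state ℓ x₁ ε ρ η (fun r => ξ r ω) k).v + P * (k + 1)) ∂μ
          - 2 * Real.log δ ∧
    ∫ ω, Real.log (state ℓ x₁ ε ρ η (fun r => ξ r ω) k).u ∂μ
        ≤ 4 * δ * ∫ ω, √((state ℓ x₁ ε ρ η (fun r => ξ r ω) k).v + P * (k + 1)) ∂μ
          - 2 * Real.log δ := by
  have hP0 : 0 < P := by rw [hP]; positivity
  have I := integrable_iteration (μ := μ) ℓ x₁ ε ρ η hξ k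
  have i1 := I fun S _ _ _ => √(S.v + P * (k + 1))
  have i2 := I fun S _ _ _ => Real.log S.v
  have i3 := I fun S _ _ _ => Real.log S.u
  have e : ∫ ω, (4 * δ * √((state ℓ x₁ ε ρ η (fun r => ξ r ω) k).v + P * (k + 1))
      - 2 * Real.log δ) ∂μ
      = 4 * δ * ∫ ω, √((state ℓ x₁ ε ρ η (fun r => ξ r ω) k).v + P * (k + 1)) ∂μ
          - 2 * Real.log δ := by
    rw [integral_sub (i1.const_mul _) (integrable_const _), integral_const_mul]
    simp
  have hε2 : 0 < ε ^ 2 := by positivity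
  have hPk : 0 < P * ((k : ℝ) + 1) := by positivity
  rw [← e]
  refine ⟨integral_mono i2 ((i1.const_mul _).sub (integrable_const _)) fun ω => ?_,
    integral_mono i3 ((i1.const_mul _).sub (integrable_const _)) fun ω => ?_⟩
  all_goals
    have hv := hε2.trans_le (le_state_v (ℓ := ℓ) (x₁ := x₁) (ρ := ρ) (η := η) (fun r => ξ r ω) k)
    have hu := hε2.trans_le (le_state_u (ℓ := ℓ) (x₁ := x₁) (ρ := ρ) (η := η) (fun r => ξ r ω) k)
    have hul := state_u_le (x₁ := x₁) (η := η) (fun r => ξ r ω) hℓ hb hε hρ k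
    have hlog := log_le_mul_sqrt_sub (add_pos hv hPk) hδ
  · exact (Real.log_le_log hv (by linarith)).trans hlog
  · refine (Real.log_le_log hu ?_).trans hlog
    have hk : (0 : ℝ) ≤ k := k.cast_nonneg
    -- The same shift absorbs the linear gap between `u` and `2 * v`.
    have : 2 * (L ^ 2 * ρ ^ 2) * k ≤ P * k := by
      gcongr
      linarith
    linarith

end Expectation

/-! ### Summation over iterations and the rate -/

section Rate

variable {d n b : ℕ} {ℓ : Fin n → EuclideanSpace ℝ (Fin d) → ℝ} {x₁ : EuclideanSpace ℝ (Fin d)}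
  {L D₀ D₁ ε ρ η : ℝ} {Ω : Type*} [MeasurableSpace Ω] {μ : Measure Ω} [IsProbabilityMeasure μ]
  {ξ : ℕ → Ω → Fin b → Fin n}

/-- The weighted squared gradients are summable up to the logarithm of the accumulators. -/
lemma sum_integral_gradTerm_le {Δ : ℝ} (hξ : UniformSampling μ ℓ x₁ ε ρ η ξ)
    (hvar : AffineVariance μ ℓ x₁ ε ρ η ξ D₀ D₁) (hℓ : LSmooth ℓ L) (hn : 0 < n) (hb : 0 < b)
    (hL : 0 < L) (hD₀ : 0 < D₀) (hD₁ : 0 < D₁) (hε : 0 < ε) (hρ : 0 ≤ ρ) (hη : 0 < η)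
    (hbdd : BddBelow (Set.range (risk ℓ))) (hΔ : risk ℓ x₁ - ⨅ y, risk ℓ y ≤ Δ) {P Q B : ℝ}
    (hP : P = 2 * D₀ + 2 * (L ^ 2 * ρ ^ 2)) (hQ : Q = 2 * D₁)
    (hB : B = (L * η + 2 * P / ε + 2 * Q * (1 + 16 * Q) * L ^ 2 * η ^ 2 / ε)
      + 2 / ε * (L ^ 2 * ρ ^ 2)) (T : ℕ) {δ : ℝ} (hδ : 0 < δ) :
    5 / 8 * ∑ k ∈ Finset.range T, ∫ ω, gradTerm ℓ (state ℓ x₁ ε ρ η (fun r => ξ r ω) k) ∂μ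
      ≤ (Δ / η + 2 * Q * (4 * L * Δ) / ε - B * Real.log (ε ^ 2))
        + B * (4 * δ * ∫ ω, √((state ℓ x₁ ε ρ η (fun r => ξ r ω) T).v + P * (T + 1)) ∂μ
          - 2 * Real.log δ) := by
  have hP0 : 0 < P := by rw [hP]; positivity
  have hQ0 : 0 < Q := by rw [hQ]; positivity
  set B₁ := L * η + 2 * P / ε + 2 * Q * (1 + 16 * Q) * L ^ 2 * η ^ 2 / ε with hB₁
  set B₂ := 2 / ε * (L ^ 2 * ρ ^ 2) with hB₂
  have hB₁0 : 0 ≤ B₁ := by positivity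
  have hB₂0 : 0 ≤ B₂ := by positivity
  have tel : ∀ m : ℕ,
      ∫ ω, potential ℓ η Q (state ℓ x₁ ε ρ η (fun r => ξ r ω) m) ∂μ
        + 5 / 8 * ∑ k ∈ Finset.range m, ∫ ω, gradTerm ℓ (state ℓ x₁ ε ρ η (fun r => ξ r ω) k) ∂μ
      ≤ potential ℓ η Q ⟨x₁, ε ^ 2, ε ^ 2⟩
        + B₁ * (∫ ω, Real.log (state ℓ x₁ ε ρ η (fun r => ξ r ω) m).v ∂μ - Real.log (ε ^ 2))
        + B₂ * (∫ ω, Real.log (state ℓ x₁ ε ρ η (fun r => ξ r ω) m).u ∂μ - Real.log (ε ^ 2)) := by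
    intro m
    induction m with
    | zero => simp [state]
    | succ m ih =>
      have := integral_potential_succ_le hξ hvar hℓ hn hb hL.le hD₀ hD₁ hε hρ hη hP hQ m
      rw [Finset.sum_range_succ]
      linarith
  have hlow : (⨅ y, risk ℓ y) / η
      ≤ ∫ ω, potential ℓ η Q (state ℓ x₁ ε ρ η (fun r => ξ r ω) T) ∂μ := by
    have : ∫ _ω, (⨅ y, risk ℓ y) / η ∂μ
        ≤ ∫ ω, potential ℓ η Q (state ℓ x₁ ε ρ η (fun r => ξ r ω) T) ∂μ := by
      refine integral_mono (integrable_const _)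
        (integrable_iteration ℓ x₁ ε ρ η hξ.1 T fun S _ _ _ => potential ℓ η Q S) fun ω => ?_
      have h1 := ciInf_le hbdd (state ℓ x₁ ε ρ η (fun r => ξ r ω) T).x
      have h2 : 0 ≤ 2 * Q * ‖gradient (risk ℓ) (state ℓ x₁ ε ρ η (fun r => ξ r ω) T).x‖ ^ 2
        / √(state ℓ x₁ ε ρ η (fun r => ξ r ω) T).v := by positivity
      have h3 := div_le_div_of_nonneg_right h1 hη.le
      simp only [potential]
      linarith
    simpa using this
  have hup : potential ℓ η Q ⟨x₁, ε ^ 2, ε ^ 2⟩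
      ≤ (⨅ y, risk ℓ y) / η + Δ / η + 2 * Q * (4 * L * Δ) / ε := by
    have h1 := hℓ.norm_gradient_risk_sq_le hL hn hbdd x₁
    have h2 : ‖gradient (risk ℓ) x₁‖ ^ 2 ≤ 4 * L * Δ := h1.trans (by gcongr)
    simp only [potential, Real.sqrt_sq hε.le]
    rw [← add_div]
    gcongr
    linarith
  obtain ⟨hlv, hlu⟩ := integral_log_state_le (μ := μ) (x₁ := x₁) (η := η) hξ.1 hℓ hb hD₀ hε hρ hP T
    hδ
  have m1 := mul_le_mul_of_nonneg_left hlv hB₁0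
  have m2 := mul_le_mul_of_nonneg_left hlu hB₂0
  have := tel T
  rw [hB]
  linarith

lemma integral_sqrt_le (hξ : ∀ t, Measurable (ξ t))
    (hvar : AffineVariance μ ℓ x₁ ε ρ η ξ D₀ D₁) (hℓ : LSmooth ℓ L) (hb : 0 < b)
    (hD₀ : 0 < D₀) (hD₁ : 0 < D₁) (hε : 0 < ε) (hρ : 0 ≤ ρ) {P Q : ℝ}
    (hP : P = 2 * D₀ + 2 * (L ^ 2 * ρ ^ 2)) (hQ : Q = 2 * D₁) (T : ℕ) :
    ∫ ω, √((state ℓ x₁ ε ρ η (fun r => ξ r ω) T).v + P * (T + 1)) ∂μ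
      ≤ √(ε ^ 2 + P) + 2 * √P * √T + Q * ∑ k ∈ Finset.range T,
        ∫ ω, gradTerm ℓ (state ℓ x₁ ε ρ η (fun r => ξ r ω) k) ∂μ := by
  induction T with
  | zero => simp [state]
  | succ m ih =>
    have := integral_sqrt_succ_le hξ hvar hℓ hb hD₀ hD₁ hε hρ hP hQ m
    rw [Finset.sum_range_succ]
    linarith

/-- A weighted arithmetic-geometric mean bound that turns the weighted squared gradients into
gradient norms. -/
lemma norm_gradient_le_add (hε : 0 < ε) (B : ℕ → Fin b → Fin n) (k : ℕ) {θ P : ℝ} (hθ : 0 < θ)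
    (hP : 0 ≤ P) :
    ‖gradient (risk ℓ) (state ℓ x₁ ε ρ η B k).x‖
      ≤ θ * gradTerm ℓ (state ℓ x₁ ε ρ η B k)
        + θ⁻¹ * √((state ℓ x₁ ε ρ η B k).v + P * (k + 1)) := by
  set S := state ℓ x₁ ε ρ η B k
  have ha : 0 < √S.v := hε.trans_le (sqrt_state_v_ge B k)
  have h1 : √S.v ≤ √(S.v + P * (k + 1)) := Real.sqrt_le_sqrt (by
    have : 0 ≤ P * ((k : ℝ) + 1) := by positivity
    linarith)
  have h2 : ‖gradient (risk ℓ) S.x‖ ≤ θ * gradTerm ℓ S + θ⁻¹ * √S.v := by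
    set N := ‖gradient (risk ℓ) S.x‖ with hN
    -- Completing the square in `θ * N`.
    have e : θ * gradTerm ℓ S + θ⁻¹ * √S.v - N
        = ((θ * N - √S.v / 2) ^ 2 + 3 / 4 * √S.v ^ 2) / (θ * √S.v) := by
      rw [gradTerm, ← hN]; field_simp; ring
    have : 0 ≤ ((θ * N - √S.v / 2) ^ 2 + 3 / 4 * √S.v ^ 2) / (θ * √S.v) := by positivity
    linarith
  have h3 := mul_le_mul_of_nonneg_left h1 (inv_pos.2 hθ).le
  linarith

lemma sum_integral_norm_gradient_le (hξ : ∀ t, Measurable (ξ t)) (hε : 0 < ε) {K S P : ℝ} {T : ℕ}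
    (hP : 0 ≤ P) (hK : 0 ≤ K)
    (hW : ∀ k < T, ∫ ω, √((state ℓ x₁ ε ρ η (fun r => ξ r ω) k).v + P * (k + 1)) ∂μ
      ≤ K * √((k : ℝ) + 1))
    (hS : ∑ k ∈ Finset.range T, ∫ ω, gradTerm ℓ (state ℓ x₁ ε ρ η (fun r => ξ r ω) k) ∂μ ≤ S)
    {θ : ℝ} (hθ : 0 < θ) :
    ∑ k ∈ Finset.range T, ∫ ω, ‖gradient (risk ℓ) (state ℓ x₁ ε ρ η (fun r => ξ r ω) k).x‖ ∂μ
      ≤ θ * S + θ⁻¹ * (T * (K * √T)) := by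
  have h1 : ∀ k ∈ Finset.range T,
      ∫ ω, ‖gradient (risk ℓ) (state ℓ x₁ ε ρ η (fun r => ξ r ω) k).x‖ ∂μ
        ≤ θ * ∫ ω, gradTerm ℓ (state ℓ x₁ ε ρ η (fun r => ξ r ω) k) ∂μ + θ⁻¹ * (K * √T) := by
    intro k hk
    have I := integrable_iteration (μ := μ) ℓ x₁ ε ρ η hξ k
    have i1 := I fun S _ _ _ => gradTerm ℓ S
    have i2 := I fun S _ _ _ => √(S.v + P * (k + 1))
    have := integral_mono (I fun S _ _ _ => ‖gradient (risk ℓ) S.x‖)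
      ((i1.const_mul θ).add (i2.const_mul θ⁻¹))
      fun ω => norm_gradient_le_add hε (fun r => ξ r ω) k hθ hP
    rw [integral_add' (i1.const_mul θ) (i2.const_mul θ⁻¹), integral_const_mul,
      integral_const_mul] at this
    refine this.trans ?_
    have hkT : ((k : ℝ) + 1) ≤ T := by exact_mod_cast Finset.mem_range.1 hk
    have h3 : K * √((k : ℝ) + 1) ≤ K * √T := by gcongr
    have h4 := (hW k (Finset.mem_range.1 hk)).trans h3
    gcongr
  refine (Finset.sum_le_sum h1).trans ?_
  rw [Finset.sum_add_distrib, ← Finset.mul_sum, Finset.sum_const, Finset.card_range, nsmul_eq_mul]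
  have := mul_le_mul_of_nonneg_left hS hθ.le
  linarith

lemma average_le_of_sum_le {K₁ K₂ S : ℝ} {T : ℕ} (hT : 2 ≤ T) (hK₂ : 0 ≤ K₂)
    (h : S ≤ (T : ℝ) ^ (3 / 4 : ℝ) * (K₁ * Real.log T)
      + ((T : ℝ) ^ (3 / 4 : ℝ))⁻¹ * (T * (K₂ * √T))) :
    1 / (T : ℝ) * S ≤ (K₁ + K₂ / Real.log 2) * (Real.log T / (T : ℝ) ^ (1 / 4 : ℝ)) := by
  have hT' : (2 : ℝ) ≤ T := by exact_mod_cast hT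
  have hT0 : (0 : ℝ) < T := by linarith
  have hl2 : 0 < Real.log 2 := Real.log_pos (by norm_num)
  have hlT : Real.log 2 ≤ Real.log T := Real.log_le_log (by norm_num) hT'
  set q := (T : ℝ) ^ (1 / 4 : ℝ) with hq
  have hq0 : 0 < q := by positivity
  have e1 : (T : ℝ) = q ^ 4 := by
    rw [hq, ← Real.rpow_natCast, ← Real.rpow_mul hT0.le]; norm_num
  have e2 : (T : ℝ) ^ (3 / 4 : ℝ) = q ^ 3 := by
    rw [hq, ← Real.rpow_natCast, ← Real.rpow_mul hT0.le]; norm_num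
  have e3 : √(T : ℝ) = q ^ 2 := by
    rw [Real.sqrt_eq_rpow, hq, ← Real.rpow_natCast, ← Real.rpow_mul hT0.le]; norm_num
  rw [e2, e3] at h
  have e4 : 1 / (T : ℝ) * (q ^ 3 * (K₁ * Real.log T) + (q ^ 3)⁻¹ * (T * (K₂ * q ^ 2)))
      = (K₁ * Real.log T + K₂) / q := by
    rw [show 1 / (T : ℝ) * (q ^ 3 * (K₁ * Real.log T) + (q ^ 3)⁻¹ * (T * (K₂ * q ^ 2)))
      = q ^ 3 / T * (K₁ * Real.log T) + (T / T) * ((q ^ 3)⁻¹ * (K₂ * q ^ 2)) by ring,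
      div_self hT0.ne']
    nth_rewrite 1 [e1]
    field_simp
  have h5 : K₂ ≤ K₂ / Real.log 2 * Real.log T := by
    rw [div_mul_eq_mul_div, le_div_iff₀ hl2]; gcongr
  calc 1 / (T : ℝ) * S
      ≤ 1 / (T : ℝ) * (q ^ 3 * (K₁ * Real.log T) + (q ^ 3)⁻¹ * (T * (K₂ * q ^ 2))) := by gcongr
    _ = (K₁ * Real.log T + K₂) / q := e4
    _ ≤ (K₁ * Real.log T + K₂ / Real.log 2 * Real.log T) / q := by gcongr
    _ = _ := by ring

/-- The convergence rate, with one constant for all problems and runs. -/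
lemma exists_rate (L D₀ D₁ ε ρ η Δ : ℝ) (hL : 0 < L) (hD₀ : 0 < D₀) (hD₁ : 0 < D₁)
    (hε : 0 < ε) (hρ : 0 ≤ ρ) (hη : 0 < η) :
    ∃ C : ℝ, ∀ (d n b : ℕ) (_ : 0 < n) (_ : 0 < b)
      (ℓ : Fin n → EuclideanSpace ℝ (Fin d) → ℝ) (x₁ : EuclideanSpace ℝ (Fin d))
      (Ω : Type*) [MeasurableSpace Ω] (μ : Measure Ω) [IsProbabilityMeasure μ]
      (ξ : ℕ → Ω → Fin b → Fin n),
      LSmooth ℓ L → UniformSampling μ ℓ x₁ ε ρ η ξ → AffineVariance μ ℓ x₁ ε ρ η ξ D₀ D₁ →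
      BddBelow (Set.range (risk ℓ)) → risk ℓ x₁ - ⨅ y, risk ℓ y ≤ Δ →
      ∀ T : ℕ, 2 ≤ T →
        (1 / (T : ℝ)) * ∑ k ∈ Finset.range T, ∫ ω,
            ‖gradient (risk ℓ) (state ℓ x₁ ε ρ η (fun r => ξ r ω) k).x‖ ∂μ
          ≤ C * (Real.log T / (T : ℝ) ^ (1 / 4 : ℝ)) := by
  obtain ⟨P, hP⟩ : ∃ P, P = 2 * D₀ + 2 * (L ^ 2 * ρ ^ 2) := ⟨_, rfl⟩
  obtain ⟨Q, hQ⟩ : ∃ Q, Q = 2 * D₁ := ⟨_, rfl⟩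
  obtain ⟨B, hB⟩ : ∃ B, B = (L * η + 2 * P / ε + 2 * Q * (1 + 16 * Q) * L ^ 2 * η ^ 2 / ε)
    + 2 / ε * (L ^ 2 * ρ ^ 2) := ⟨_, rfl⟩
  have hP0 : 0 < P := by rw [hP]; positivity
  have hQ0 : 0 < Q := by rw [hQ]; positivity
  have hB0 : 0 ≤ B := by rw [hB]; positivity
  set A := Δ / η + 2 * Q * (4 * L * Δ) / ε - B * Real.log (ε ^ 2) with hA
  obtain ⟨K, hK0, hK⟩ := exists_le_mul_sqrt A B Q √(ε ^ 2 + P) (2 * √P)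
    hB0 hQ0 (by positivity) (by positivity)
  refine ⟨8 / 5 * ((|A| + 4 * B * K) / Real.log 2 + 2 * B) + K / Real.log 2,
    fun d n b hn hb ℓ x₁ Ω _ μ _ ξ hℓ hξ hvar hbdd hΔ T hT => ?_⟩
  have hS := fun (m : ℕ) (δ : ℝ) (hδ : 0 < δ) =>
    sum_integral_gradTerm_le hξ hvar hℓ hn hb hL hD₀ hD₁ hε hρ hη hbdd hΔ hP hQ hB m hδ
  have hW := fun m : ℕ => hK _ _ m (hS m)
    (integral_sqrt_le hξ.1 hvar hℓ hb hD₀ hD₁ hε hρ hP hQ m)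
  have hT0 : (0 : ℝ) < T := by exact_mod_cast (by omega : 0 < T)
  -- Unification with `average_le_of_sum_le` sets `θ = T ^ (3 / 4)`, which balances `θ * log T`
  -- against `θ⁻¹ * T ^ (3 / 2)` up to the logarithm.
  exact average_le_of_sum_le hT hK0 (sum_integral_norm_gradient_le hξ.1 hε hP0.le hK0
    (fun k _ => hW k) (le_mul_log hB0 hK0 hT (hS T) (hW T)) (by positivity))

end Rate

/-! ### Growth of `A₆` and `A₇` -/

section Constants

open Asymptotics Filter

variable (L D₀ D₁ ε ρ η G N F W : ℝ)

lemma isBigO_const_sqrt (c : ℝ) : (fun _ : ℕ => c) =O[atTop] fun T : ℕ => √(T : ℝ) := by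
  refine IsBigO.of_bound |c| ((eventually_ge_atTop 1).mono fun T hT => ?_)
  have : 1 ≤ √(T : ℝ) := Real.one_le_sqrt.2 (by exact_mod_cast hT)
  rw [Real.norm_eq_abs, Real.norm_of_nonneg (by positivity)]
  exact le_mul_of_one_le_right (abs_nonneg c) this

lemma isBigO_A6 : A6 L D₀ D₁ ε ρ η G N F W =O[atTop] fun T : ℕ => √(T : ℝ) := by
  have h1 : (fun T : ℕ => 2 * √(2 * D₀ * T + ε ^ 2)) =O[atTop] fun T : ℕ => √(T : ℝ) := by
    refine IsBigO.const_mul_left (IsBigO.of_bound √(2 * |D₀| + ε ^ 2)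
      ((eventually_ge_atTop 1).mono fun T hT => ?_)) 2
    have hT' : (1 : ℝ) ≤ T := by exact_mod_cast hT
    rw [Real.norm_of_nonneg (by positivity), Real.norm_of_nonneg (by positivity),
      ← Real.sqrt_mul (by positivity)]
    refine Real.sqrt_le_sqrt ?_
    have h2 : D₀ * T ≤ |D₀| * T := by gcongr; exact le_abs_self D₀
    nlinarith [sq_nonneg ε]
  exact (h1.add (isBigO_const_sqrt _)).add (isBigO_const_sqrt _)

/-- An upper bound on `A₆` alone does not bound `|log A₆|`; divergence makes the logarithm
eventually nonnegative, whatever the signs of the other constants. -/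
lemma tendsto_A6 (hD₀ : 0 < D₀) : Tendsto (A6 L D₀ D₁ ε ρ η G N F W) atTop atTop := by
  have h1 : Tendsto (fun T : ℕ => 2 * D₀ * T + ε ^ 2) atTop atTop :=
    tendsto_atTop_add_const_right _ _
      (tendsto_natCast_atTop_atTop.const_mul_atTop (by positivity : 0 < 2 * D₀))
  exact tendsto_atTop_add_const_right _ _ (tendsto_atTop_add_const_right _ _
    ((Real.tendsto_sqrt_atTop.comp h1).const_mul_atTop two_pos))

lemma isBigO_log_of_isBigO_sqrt {f : ℕ → ℝ} (hf : f =O[atTop] fun T : ℕ => √(T : ℝ))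
    (hf' : Tendsto f atTop atTop) :
    (fun T => Real.log (f T)) =O[atTop] fun T : ℕ => Real.log T := by
  obtain ⟨c, hc, h⟩ := hf.exists_pos
  rw [IsBigOWith] at h
  have hlog : ∀ᶠ T : ℕ in atTop, |Real.log c| ≤ Real.log T :=
    (Real.tendsto_log_atTop.comp tendsto_natCast_atTop_atTop).eventually_ge_atTop _
  refine IsBigO.of_bound 2 ?_
  filter_upwards [h, hf'.eventually_ge_atTop 1, hlog, eventually_ge_atTop 1] with T h1 h2 h3 h4
  have hT : (1 : ℝ) ≤ T := by exact_mod_cast h4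
  have hlT : 0 ≤ Real.log T := Real.log_nonneg hT
  rw [Real.norm_of_nonneg (by positivity), Real.norm_of_nonneg (by positivity)] at h1
  rw [Real.norm_of_nonneg (Real.log_nonneg h2), Real.norm_of_nonneg hlT]
  have hs : 0 < √(T : ℝ) := Real.sqrt_pos.2 (by linarith)
  have h5 := Real.log_le_log (by linarith) h1
  rw [Real.log_mul hc.ne' hs.ne', Real.log_sqrt (by linarith)] at h5
  linarith [le_abs_self (Real.log c)]

lemma isBigO_A7 (hD₀ : 0 < D₀) :
    A7 L D₀ D₁ ε ρ η G N F W =O[atTop] fun T : ℕ => √(T : ℝ) + Real.log T := by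
  have hs : (fun T : ℕ => √(T : ℝ)) =O[atTop] fun T : ℕ => √(T : ℝ) + Real.log T := by
    refine IsBigO.of_bound 1 ((eventually_ge_atTop 1).mono fun T hT => ?_)
    have hlT : 0 ≤ Real.log T := Real.log_natCast_nonneg T
    rw [Real.norm_of_nonneg (by positivity), Real.norm_of_nonneg (by positivity)]
    linarith
  have hl : (fun T : ℕ => Real.log T) =O[atTop] fun T : ℕ => √(T : ℝ) + Real.log T := by
    refine IsBigO.of_bound 1 ((eventually_ge_atTop 1).mono fun T hT => ?_)
    have hlT : 0 ≤ Real.log T := Real.log_natCast_nonneg T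
    rw [Real.norm_of_nonneg (by positivity), Real.norm_of_nonneg (by positivity)]
    linarith [Real.sqrt_nonneg (T : ℝ)]
  have h6 := isBigO_A6 L D₀ D₁ ε ρ η G N F W
  have hlog := (isBigO_log_of_isBigO_sqrt h6 (tendsto_A6 L D₀ D₁ ε ρ η G N F W hD₀)).trans hl
  exact (((h6.trans hs).const_mul_left _).add ((isBigO_const_sqrt _).trans hs)).add
    ((((isBigO_const_sqrt _).trans hs).add (hlog.const_mul_left _)).const_mul_left _)

end Constants
end LightSAM

end

theorem corollary1 (L D₀ D₁ ε ρ η Δ : ℝ) (hL : 0 ≤ L) (hD₀ : 0 < D₀) (hD₁ : 0 < D₁)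
    (hε : 0 < ε) (hρ : 0 ≤ ρ) (hη : 0 < η) :
    ∃ C : ℝ, ∀ (d n b : ℕ) (_ : 0 < n) (_ : 0 < b)
      (ℓ : Fin n → EuclideanSpace ℝ (Fin d) → ℝ) (x₁ : EuclideanSpace ℝ (Fin d))
      (Ω : Type*) [MeasurableSpace Ω] (μ : MeasureTheory.Measure Ω)
      [MeasureTheory.IsProbabilityMeasure μ] (ξ : ℕ → Ω → Fin b → Fin n),
      LightSAM.LSmooth ℓ L →
      LightSAM.UniformSampling μ ℓ x₁ ε ρ η ξ →
      LightSAM.AffineVariance μ ℓ x₁ ε ρ η ξ D₀ D₁ →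
      BddBelow (Set.range (LightSAM.risk ℓ)) →
      LightSAM.risk ℓ x₁ - ⨅ y, LightSAM.risk ℓ y ≤ Δ →
      (LightSAM.runA6 μ ℓ x₁ ε ρ η ξ L D₀ D₁ =O[Filter.atTop] fun T : ℕ => √(T : ℝ)) ∧
      (LightSAM.runA7 μ ℓ x₁ ε ρ η ξ L D₀ D₁
        =O[Filter.atTop] fun T : ℕ => √(T : ℝ) + Real.log T) ∧
      (∀ t : ℕ, 1 ≤ t → MeasureTheory.Integrable (fun ω =>
        ‖gradient (LightSAM.risk ℓ) (LightSAM.iterate ℓ x₁ ε ρ η (fun r => ξ r ω) t)‖) μ) ∧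
      ∀ T : ℕ, 2 ≤ T →
        (1 / (T : ℝ)) * ∑ t ∈ Finset.Icc 1 T, ∫ ω,
            ‖gradient (LightSAM.risk ℓ) (LightSAM.iterate ℓ x₁ ε ρ η (fun r => ξ r ω) t)‖ ∂μ
          ≤ C * (Real.log T / (T : ℝ) ^ (1 / 4 : ℝ)) := by
  -- The smoothness constant is enlarged to `L + 1` so that it is positive, as a gradient step of
  -- size `1 / (2 * L)` requires.
  obtain ⟨C, hC⟩ := LightSAM.exists_rate (L + 1) D₀ D₁ ε ρ η Δ (by linarith) hD₀ hD₁ hε hρ hη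
  refine ⟨C, fun d n b hn hb ℓ x₁ Ω _ μ _ ξ hℓ hξ hvar hbdd hΔ => ⟨?_, ?_, fun t _ => ?_,
    fun T hT => ?_⟩⟩
  · exact LightSAM.isBigO_A6 _ _ _ _ _ _ _ _ _ _
  · exact LightSAM.isBigO_A7 _ _ _ _ _ _ _ _ _ _ hD₀
  · exact LightSAM.integrable_iteration ℓ x₁ ε ρ η hξ.1 (t - 1)
      fun S _ _ _ => ‖gradient (LightSAM.risk ℓ) S.x‖
  · have := hC d n b hn hb ℓ x₁ Ω μ ξ (hℓ.mono (by linarith)) hξ hvar hbdd hΔ T hT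
    -- Index shift: the iterate `x_t` is stored in the state after `t - 1` iterations.
    rw [Finset.range_eq_Ico, Finset.sum_Ico_eq_sum_range] at this
    rw [← Finset.Ico_add_one_right_eq_Icc, Finset.sum_Ico_eq_sum_range]
    simpa [LightSAM.iterate] using this
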